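/- Let $T\ge 1$ be an integer and $\mathcal T=\{1,\dots,T\}$. Consider the following *special model* on a probability space. For each accident year $j\in\mathcal T$, let $(D_{j,k},Z_{j,k})_{k\ge 1}$ be an i.i.d. sequence of (development year, claim size) pairs with values in $\mathcal T\times\mathbb R$, whose common law, that of a generic pair $(D,Z)$, does not depend on $j$; assume that $D$ and $Z$ are independent, $E[Z^2]<\infty$ and $E[Z\,1\{D=t\}]>0$ for each $t\in\mathcal T$. For each $j\in\mathcal T$, let $(M^\alpha_j)_{\alpha\ge 0}$ be a homogeneous Poisson process with intensity $\lambda_j\in(0,\infty)$, independent of $(D_{j,k},Z_{j,k})_{k\ge1}$, and let the $T$ collections $\{(M^\alpha_j)_{\alpha\ge0},(D_{j,k},Z_{j,k})_{k\ge1}\}$, $j\in\mathcal T$, be independent. Put $$C^\alpha_{j,t}=\sum_{k=1}^{M^\alpha_j}Z_{j,k}1\{D_{j,k}\le t\},\qquad f_t=\frac{E[Z\,1\{D\le t+1\}]}{E[Z\,1\{D\le t\}]},\qquad \widehat f_t=\widehat f^{\,\alpha}_t=\frac{\sum_{j=1}^{T-t}C^\alpha_{j,t+1}}{\sum_{j=1}^{T-t}C^\alpha_{j,t}},$$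 where a quotient with denominator $0$ is read as $0$, and let $\mathcal D^\alpha$ be the $\sigma$-algebra generated by $\{C^\alpha_{j,t}: j,t\in\mathcal T,\ j+t\le T+1\}$. Fix $i\in\mathcal T$ and, for $\alpha>0$, let $$A^\alpha_1=\alpha^{-1/2}\,E\Big[C^\alpha_{i,T}-C^\alpha_{i,T-i+1}\prod_{s=T-i+1}^{T-1}f_s\,\Big|\,\mathcal D^\alpha\Big],\qquad A^\alpha_2=\alpha^{1/2}\Big(\prod_{s=T-i+1}^{T-1}f_s-\prod_{s=T-i+1}^{T-1}\widehat f_s\Big),$$ with $A_1^0=A_2^0=0$; the conditioned variable is integrable for every $\alpha$. Then the processes $(A^\alpha_1)_{\alpha\ge0}$ and $(A^\alpha_2)_{\alpha\ge0}$ are independent and, as $\alpha\to\infty$, each of them converges in distribution to a normally distributed random variable with zero mean. The limiting variances are positive if $i\ge2$ (for $i=1$ the products are empty and both processes vanish almost surely, for each $\alpha$). Moreover $A^\alpha_1A^\alpha_2$ converges in distribution, as $\alpha\to\infty$, to an integrable random variable with zero mean. -/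

import Mathlib

open MeasureTheory ProbabilityTheory Filter
open scoped NNReal Topology

namespace ChainLadder

/-- `N` is a homogeneous Poisson process with intensity `r` under `P`: a counting process started
at `0`, with nondecreasing right-continuous paths and independent Poisson increments.
(The truncated subtraction of `ℕ` is harmless because almost all paths are nondecreasing.) -/
structure IsPoissonProcess {Ω : Type*} [MeasurableSpace Ω] (N : ℝ≥0 → Ω → ℕ) (r : ℝ≥0)
    (P : Measure Ω) : Prop where
  measurable : ∀ a, Measurable (N a)
  start_zero : ∀ᵐ ω ∂P, N 0 ω = 0
  path_monotone : ∀ᵐ ω ∂P, Monotone fun a => N a ω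
  path_rightContinuous : ∀ᵐ ω ∂P, ∀ a, ContinuousWithinAt (fun b => N b ω) (Set.Ici a) a
  indep_increments : HasIndepIncrements N P
  increment_law : ∀ a b, a ≤ b →
    HasLaw (fun ω => N b ω - N a ω) (poissonMeasure (r * (b - a))) P

/-- The special model with `T` accident years and `T` development years, both numbered
`1, …, T`, on a probability space `(Ω, P)`.

* `lam i` is the intensity of the claims of accident year `i`;
* `ν` is the law on `ℕ × ℝ` of a generic pair `(D, Z)` (development year, claim size);
* `D i k` and `Z i k` are the development year and the size of claim number `k + 1`
  of accident year `i`;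
* `M i α` is the number of accident events in accident year `i` at exposure `α`. -/
structure IsSpecialModel {Ω : Type*} [MeasurableSpace Ω] (P : Measure Ω) (T : ℕ) (lam : ℕ → ℝ≥0)
    (ν : Measure (ℕ × ℝ)) (D : ℕ → ℕ → Ω → ℕ) (Z : ℕ → ℕ → Ω → ℝ)
    (M : ℕ → ℝ≥0 → Ω → ℕ) : Prop where
  measurable_D : ∀ i ∈ Finset.Icc 1 T, ∀ k, Measurable (D i k)
  measurable_Z : ∀ i ∈ Finset.Icc 1 T, ∀ k, Measurable (Z i k)
  /-- All pairs `(D i k, Z i k)` have the law of the generic pair. -/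
  pair_law : ∀ i ∈ Finset.Icc 1 T, ∀ k, HasLaw (fun ω => (D i k ω, Z i k ω)) ν P
  /-- Within an accident year the pairs are independent. -/
  pair_indep : ∀ i ∈ Finset.Icc 1 T, iIndepFun (fun k ω => (D i k ω, Z i k ω)) P
  /-- Development years lie in `{1, …, T}`. -/
  development_year : ∀ᵐ p ∂ν, p.1 ∈ Finset.Icc 1 T
  /-- `E[Z²] < ∞`. -/
  second_moment : MemLp (fun p : ℕ × ℝ => p.2) 2 ν
  /-- `E[Z 1{D = t}] > 0` for every `t`. -/
  mean_pos : ∀ t ∈ Finset.Icc 1 T, 0 < ∫ p, (if p.1 = t then p.2 else 0) ∂ν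
  /-- Within an accident year, the counting process and the claims are independent. -/
  count_indep_claims : ∀ i ∈ Finset.Icc 1 T,
    IndepFun (fun ω (α : ℝ≥0) => M i α ω) (fun ω (k : ℕ) => (D i k ω, Z i k ω)) P
  /-- The data of the different accident years are independent. -/
  years_indep : iIndepFun
    (fun (i : Finset.Icc 1 T) (ω : Ω) =>
      ((fun (α : ℝ≥0) => M i α ω), (fun (k : ℕ) => (D i k ω, Z i k ω)))) P
  /-- The generic development year and the generic claim size are independent. -/
  year_indep_size : IndepFun (fun p : ℕ × ℝ => p.1) (fun p : ℕ × ℝ => p.2) ν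
  intensity_pos : ∀ i ∈ Finset.Icc 1 T, 0 < lam i
  poisson : ∀ i ∈ Finset.Icc 1 T, IsPoissonProcess (M i) (lam i) P

/-- The accumulated claims amount `C^α_{i,t} = ∑_{k ≤ M^α_i} Z_{i,k} 1{D_{i,k} ≤ t}`. -/
noncomputable def accClaims {Ω : Type*} (D : ℕ → ℕ → Ω → ℕ) (Z : ℕ → ℕ → Ω → ℝ)
    (M : ℕ → ℝ≥0 → Ω → ℕ) (i t : ℕ) (α : ℝ≥0) (ω : Ω) : ℝ :=
  ∑ k ∈ Finset.range (M i α ω), if D i k ω ≤ t then Z i k ω else 0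

/-- `f_t = E[Z 1{D ≤ t + 1}] / E[Z 1{D ≤ t}]`. -/
noncomputable def devFactor (ν : Measure (ℕ × ℝ)) (t : ℕ) : ℝ :=
  (∫ p, (if p.1 ≤ t + 1 then p.2 else 0) ∂ν) / ∫ p, (if p.1 ≤ t then p.2 else 0) ∂ν

/-- The chain ladder estimator
`(∑_{j=1}^{T-t} C^α_{j,t+1}) / (∑_{j=1}^{T-t} C^α_{j,t})` of `f_t`. -/
noncomputable def devFactorEst {Ω : Type*} (T : ℕ) (D : ℕ → ℕ → Ω → ℕ) (Z : ℕ → ℕ → Ω → ℝ)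
    (M : ℕ → ℝ≥0 → Ω → ℕ) (t : ℕ) (α : ℝ≥0) (ω : Ω) : ℝ :=
  (∑ j ∈ Finset.Icc 1 (T - t), accClaims D Z M j (t + 1) α ω) /
    ∑ j ∈ Finset.Icc 1 (T - t), accClaims D Z M j t α ω

/-- The σ-algebra generated by the observed run-off triangle
`{C^α_{j,t} : 1 ≤ j, t ≤ T, j + t ≤ T + 1}`. -/
@[reducible] noncomputable def triangleSigma {Ω : Type*} (T : ℕ) (D : ℕ → ℕ → Ω → ℕ) (Z : ℕ → ℕ → Ω → ℝ)
    (M : ℕ → ℝ≥0 → Ω → ℕ) (α : ℝ≥0) : MeasurableSpace Ω :=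
  ⨆ j ∈ Finset.Icc 1 T, ⨆ t ∈ Finset.Icc 1 T, ⨆ (_ : j + t ≤ T + 1),
    MeasurableSpace.comap (accClaims D Z M j t α) (inferInstance : MeasurableSpace ℝ)

/-- The product `∏_{s=T-i+1}^{T-1} f_s`. -/
noncomputable def factorProd (T : ℕ) (ν : Measure (ℕ × ℝ)) (i : ℕ) : ℝ :=
  ∏ s ∈ Finset.Ico (T - i + 1) T, devFactor ν s

/-- The product of the estimators of `f_s` over `s = T-i+1, …, T-1`. -/
noncomputable def factorEstProd {Ω : Type*} (T : ℕ) (D : ℕ → ℕ → Ω → ℕ) (Z : ℕ → ℕ → Ω → ℝ)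
    (M : ℕ → ℝ≥0 → Ω → ℕ) (i : ℕ) (α : ℝ≥0) (ω : Ω) : ℝ :=
  ∏ s ∈ Finset.Ico (T - i + 1) T, devFactorEst T D Z M s α ω

/-- `C^α_{i,T} - C^α_{i,T-i+1} ∏ f_s`. -/
noncomputable def predError {Ω : Type*} (T : ℕ) (ν : Measure (ℕ × ℝ)) (D : ℕ → ℕ → Ω → ℕ)
    (Z : ℕ → ℕ → Ω → ℝ) (M : ℕ → ℝ≥0 → Ω → ℕ) (i : ℕ) (α : ℝ≥0) (ω : Ω) : ℝ :=
  accClaims D Z M i T α ω - accClaims D Z M i (T - i + 1) α ω * factorProd T ν i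

/-- `A₁^α = α^{-1/2} E[C^α_{i,T} - C^α_{i,T-i+1} ∏ f_s | 𝒟^α]`. -/
noncomputable def A1 {Ω : Type*} [MeasurableSpace Ω] (P : Measure Ω) (T : ℕ)
    (ν : Measure (ℕ × ℝ)) (D : ℕ → ℕ → Ω → ℕ) (Z : ℕ → ℕ → Ω → ℝ) (M : ℕ → ℝ≥0 → Ω → ℕ)
    (i : ℕ) (α : ℝ≥0) (ω : Ω) : ℝ :=
  (α : ℝ) ^ (-(1 / 2) : ℝ) * (P[predError T ν D Z M i α | triangleSigma T D Z M α]) ω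

/-- `A₂^α = α^{1/2} (∏ f_s - ∏ f̂_s)`. -/
noncomputable def A2 {Ω : Type*} (T : ℕ) (ν : Measure (ℕ × ℝ)) (D : ℕ → ℕ → Ω → ℕ)
    (Z : ℕ → ℕ → Ω → ℝ) (M : ℕ → ℝ≥0 → Ω → ℕ) (i : ℕ) (α : ℝ≥0) (ω : Ω) : ℝ :=
  (α : ℝ) ^ ((1 / 2) : ℝ) * (factorProd T ν i - factorEstProd T D Z M i α ω)

end ChainLadder

/-!
For the accident year `i` put `r = T - i + 1` and `m_t = E[Z 1{D ≤ t}]`. Only the values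
`f_t = m_{t+1} / m_t` of the development factors and the compound Poisson structure matter.

*Compound Poisson sums.* For every weight `h`, the sum of `h (D, Z)` over the claims of one accident
year at exposure `α` is a compound Poisson sum, with characteristic function
`u ↦ exp (λ α E[exp (√-1 u h(D, Z)) - 1])` (`IsPoissonMarked.charFun_sum`). Two consequences carry the proof.
If two weights are never both nonzero, the exponent is additive, so the two sums are independent
(`IsPoissonMarked.indepFun_sum`, Poisson thinning). If `h` is square integrable, the sum, centred at
its mean and divided by `√α`, is asymptotically normal with variance `λ E[h²]`; Lévy's theorem gives
the same for sums over several independent years (`tendstoInDistribution_compoundPoisson`).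

*The process `A₁`.* The claims of year `i` reported after development year `r` are independent of
the observed triangle: of the early claims of year `i` by thinning, of the other years by
assumption. Their conditional expectation is therefore a constant, and since `∏ f_s = m_T / m_r`
telescopes, `A₁` is almost surely a centred and scaled sum over the claims of year `i` with weight
`(1 - m_T / m_r) z 1{d ≤ r}` (`IsSpecialModel.A1_ae_eq`), to which the central limit theorem
applies.

*The process `A₂`.* It involves the years before `i` only, hence is independent of `A₁`. The scaled
error telescopes into a sum over `s` of the terms `α^{-1/2} ∑_j (C_{j,s+1} - f_s C_{j,s})`, which
converge in distribution, with random coefficients that converge in probability to positive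
constants. Replacing the coefficients by their limits costs an error that tends to zero in
probability (`IsSpecialModel.tendstoInMeasure_A2_sub`), and leaves a scaled sum over the claims of
the years before `i` with centred weights, to which the central limit theorem applies again. The
limit variance is positive because a claim of year `1` reported in development year `T` enters
through the factor `f_{T-1}` alone.

*The product.* By independence the pair `(A₁, A₂)` converges to a product of centred normal laws,
and the product of two independent centred integrable variables is integrable and centred.
-/

namespace ChainLadder

/-! ### Convergence in probability and in distribution -/

section Convergence

variable {Ω ι : Type*} {mΩ : MeasurableSpace Ω} {P : Measure Ω} {l : Filter ι}

theorem tendstoInMeasure_const_comp₂ {X Y : ι → Ω → ℝ} {a b : ℝ} {g : ℝ × ℝ → ℝ}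
    (hg : ContinuousAt g (a, b)) (hX : TendstoInMeasure P X l fun _ => a)
    (hY : TendstoInMeasure P Y l fun _ => b) :
    TendstoInMeasure P (fun n ω => g (X n ω, Y n ω)) l fun _ => g (a, b) := by
  rw [tendstoInMeasure_iff_dist] at *
  intro ε hε
  obtain ⟨δ, hδ, h⟩ := Metric.continuousAt_iff.1 hg ε hε
  have hsum := (hX δ hδ).add (hY δ hδ)
  rw [add_zero] at hsum
  refine tendsto_of_tendsto_of_tendsto_of_le_of_le tendsto_const_nhds hsum
    (fun _ => zero_le) fun n => ?_
  refine (measure_mono fun ω hω => ?_).trans (measure_union_le _ _)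
  by_contra hcon
  simp only [Set.mem_union, Set.mem_ofPred_eq, not_or, not_le] at hcon hω
  exact absurd (h (x := (X n ω, Y n ω)) (by simpa [Prod.dist_eq] using hcon)) (not_lt.2 hω)

theorem tendstoInMeasure_const {a : ℝ} : TendstoInMeasure P (fun (_ : ι) _ => a) l fun _ => a := by
  rw [tendstoInMeasure_iff_dist]
  intro ε hε
  simpa [not_le.2 hε] using tendsto_const_nhds

theorem tendstoInMeasure_of_tendsto {x : ι → ℝ} {a : ℝ} (h : Tendsto x l (𝓝 a)) :
    TendstoInMeasure P (fun n _ => x n) l fun _ => a := by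
  rw [tendstoInMeasure_iff_dist]
  intro ε hε
  refine tendsto_const_nhds.congr' ?_
  filter_upwards [Metric.tendsto_nhds.1 h ε hε] with n hn
  simp [not_le.2 hn]

theorem tendstoInMeasure_const_finset_sum {κ : Type*} (s : Finset κ) {X : κ → ι → Ω → ℝ}
    {a : κ → ℝ} (h : ∀ k ∈ s, TendstoInMeasure P (X k) l fun _ => a k) :
    TendstoInMeasure P (fun n ω => ∑ k ∈ s, X k n ω) l fun _ => ∑ k ∈ s, a k := by
  classical
  induction s using Finset.induction_on with
  | empty => simpa using tendstoInMeasure_const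
  | insert k s hk ih =>
    simp only [Finset.sum_insert hk]
    exact tendstoInMeasure_const_comp₂ (g := fun p => p.1 + p.2) (by fun_prop)
      (h k (Finset.mem_insert_self _ _)) (ih fun k' hk' => h k' (Finset.mem_insert_of_mem hk'))

theorem tendstoInMeasure_const_finset_prod {κ : Type*} (s : Finset κ) {X : κ → ι → Ω → ℝ}
    {a : κ → ℝ} (h : ∀ k ∈ s, TendstoInMeasure P (X k) l fun _ => a k) :
    TendstoInMeasure P (fun n ω => ∏ k ∈ s, X k n ω) l fun _ => ∏ k ∈ s, a k := by
  classical
  induction s using Finset.induction_on with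
  | empty => simpa using tendstoInMeasure_const
  | insert k s hk ih =>
    simp only [Finset.prod_insert hk]
    exact tendstoInMeasure_const_comp₂ (g := fun p => p.1 * p.2) (by fun_prop)
      (h k (Finset.mem_insert_self _ _)) (ih fun k' hk' => h k' (Finset.mem_insert_of_mem hk'))

/-- Values on an event whose probability tends to zero are irrelevant for convergence in
probability. -/
theorem tendstoInMeasure_of_eqOn_compl {X Y : ι → Ω → ℝ} {Z : Ω → ℝ}
    (hX : TendstoInMeasure P X l Z) {E : ι → Set Ω} (hE : Tendsto (fun n => P (E n)) l (𝓝 0))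
    (hXY : ∀ᶠ n in l, ∀ ω, ω ∉ E n → Y n ω = X n ω) : TendstoInMeasure P Y l Z := by
  rw [tendstoInMeasure_iff_dist] at *
  intro ε hε
  have hsum := (hX ε hε).add hE
  rw [add_zero] at hsum
  refine tendsto_of_tendsto_of_tendsto_of_le_of_le' tendsto_const_nhds hsum
    (Eventually.of_forall fun _ => zero_le) ?_
  filter_upwards [hXY] with n hn
  refine (measure_mono fun ω hω => ?_).trans (measure_union_le _ _)
  by_cases h : ω ∈ E n
  · exact Or.inr h
  · left
    simpa [hn ω h] using hω

theorem tendsto_measure_eq_zero_of_tendstoInMeasure {X : ι → Ω → ℝ} {a : ℝ} (ha : a ≠ 0)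
    (hX : TendstoInMeasure P X l fun _ => a) :
    Tendsto (fun n => P {ω | X n ω = 0}) l (𝓝 0) := by
  rw [tendstoInMeasure_iff_dist] at hX
  refine tendsto_of_tendsto_of_tendsto_of_le_of_le tendsto_const_nhds (hX |a| (abs_pos.2 ha))
    (fun _ => zero_le) fun n => measure_mono fun ω hω => ?_
  simp only [Set.mem_ofPred_eq] at hω ⊢
  simp [hω, Real.dist_eq]

variable [IsProbabilityMeasure P]

/-- Convergence in distribution to a constant implies convergence in probability. -/
theorem tendstoInMeasure_of_tendstoInDistribution_const {Ω' : Type*} {mΩ' : MeasurableSpace Ω'}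
    {P' : Measure Ω'} [IsProbabilityMeasure P'] {X : ι → Ω → ℝ} {a : ℝ}
    (h : TendstoInDistribution X l (fun _ : Ω' => a) (fun _ => P) P') :
    TendstoInMeasure P X l fun _ => a := by
  rw [tendstoInMeasure_iff_dist]
  intro ε hε
  have hset : MeasurableSet {x : ℝ | ε ≤ dist x a} :=
    (isClosed_le (by fun_prop) (by fun_prop)).measurableSet
  have hfr : frontier {x : ℝ | ε ≤ dist x a} ⊆ {x | ε = dist x a} :=
    frontier_le_subset_eq (by fun_prop) (by fun_prop)
  have := ProbabilityMeasure.tendsto_measure_of_null_frontier_of_tendsto' h.tendsto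
    (E := {x : ℝ | ε ≤ dist x a}) (by
      refine measure_mono_null hfr ?_
      rw [ProbabilityMeasure.coe_mk, Measure.map_const]
      simp [hε.ne'])
  simp only [ProbabilityMeasure.coe_mk, Measure.map_const] at this
  simp_rw [fun n => Measure.map_apply_of_aemeasurable (h.forall_aemeasurable n) hset] at this
  simpa [hε] using this

/-- A sequence that converges in distribution, times one that converges to zero in probability,
converges to zero in probability. -/
theorem tendstoInMeasure_mul_zero_of_tendstoInDistribution [l.IsCountablyGenerated]
    {Ω' : Type*} {mΩ' : MeasurableSpace Ω'} {P' : Measure Ω'} [IsProbabilityMeasure P']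
    {X Y : ι → Ω → ℝ} {Z : Ω' → ℝ} (hX : TendstoInDistribution X l Z (fun _ => P) P')
    (hY : TendstoInMeasure P Y l fun _ => 0) (hYm : ∀ n, AEMeasurable (Y n) P) :
    TendstoInMeasure P (fun n ω => X n ω * Y n ω) l fun _ => 0 := by
  refine tendstoInMeasure_of_tendstoInDistribution_const (P' := P') ?_
  simpa using hX.continuous_comp_prodMk_of_tendstoInMeasure_const
    (g := fun p : ℝ × ℝ => p.1 * p.2) (by fun_prop) hY hYm

/-- The product of two independent sequences converging in distribution converges in distribution
to the product of independent copies of the limits. -/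
theorem tendstoInDistribution_mul_of_indepFun {μ ν : Measure ℝ} [IsProbabilityMeasure μ]
    [IsProbabilityMeasure ν] {X Y : ι → Ω → ℝ}
    (hX : TendstoInDistribution X l (id : ℝ → ℝ) (fun _ => P) μ)
    (hY : TendstoInDistribution Y l (id : ℝ → ℝ) (fun _ => P) ν)
    (hind : ∀ n, IndepFun (X n) (Y n) P) :
    TendstoInDistribution (fun n ω => X n ω * Y n ω) l (fun p : ℝ × ℝ => p.1 * p.2)
      (fun _ => P) (μ.prod ν) := by
  have key : TendstoInDistribution (fun n ω => (X n ω, Y n ω)) l (id : ℝ × ℝ → ℝ × ℝ)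
      (fun _ => P) (μ.prod ν) := by
    refine ⟨fun n => (hX.forall_aemeasurable n).prodMk (hY.forall_aemeasurable n),
      aemeasurable_id, ?_⟩
    have h := (ProbabilityMeasure.continuous_prod (α := ℝ) (β := ℝ)).tendsto _ |>.comp
      (hX.tendsto.prodMk_nhds hY.tendsto)
    have hlim : (⟨(μ.prod ν).map id, Measure.isProbabilityMeasure_map aemeasurable_id⟩ :
        ProbabilityMeasure (ℝ × ℝ)) =
        ProbabilityMeasure.prod ⟨μ.map id, Measure.isProbabilityMeasure_map aemeasurable_id⟩
          ⟨ν.map id, Measure.isProbabilityMeasure_map aemeasurable_id⟩ :=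
      Subtype.ext (by
        change (μ.prod ν).map id = (μ.map id).prod (ν.map id)
        simp only [Measure.map_id])
    rw [hlim]
    refine h.congr fun n => Subtype.ext ?_
    exact ((indepFun_iff_map_prod_eq_prod_map_map (hX.forall_aemeasurable n)
      (hY.forall_aemeasurable n)).1 (hind n)).symm
  exact key.continuous_comp (g := fun p : ℝ × ℝ => p.1 * p.2) (by fun_prop)

/-- Lévy's continuity theorem along a countably generated filter. -/
theorem tendstoInDistribution_of_tendsto_charFun [l.IsCountablyGenerated] {X : ι → Ω → ℝ}
    {μ : Measure ℝ} [IsProbabilityMeasure μ] (hX : ∀ n, AEMeasurable (X n) P)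
    (h : ∀ t, Tendsto (fun n => charFun (P.map (X n)) t) l (𝓝 (charFun μ t))) :
    TendstoInDistribution X l (id : ℝ → ℝ) (fun _ => P) μ := by
  refine ⟨hX, aemeasurable_id, tendsto_of_seq_tendsto fun u hu => ?_⟩
  refine ProbabilityMeasure.tendsto_of_tendsto_charFun fun t => ?_
  have := (h t).comp hu
  simp only [ProbabilityMeasure.coe_mk, Measure.map_id]
  exact this

end Convergence

/-! ### Compound Poisson sums -/

section CompoundPoisson

theorem hasSum_natCast_poisson (r : ℝ≥0) :
    HasSum (fun n : ℕ => Real.exp (-r) * r ^ n / n.factorial * (n : ℝ)) r := by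
  rw [← hasSum_nat_add_iff' 1]
  simp only [Finset.range_one, Finset.sum_singleton, Nat.cast_zero, mul_zero, sub_zero]
  convert! (hasSum_one_poissonMeasure r).mul_left (r : ℝ) using 1
  · ext n
    rw [Nat.factorial_succ, pow_succ]
    push_cast
    field_simp
  · rw [mul_one]

theorem integrable_natCast_poissonMeasure (r : ℝ≥0) :
    Integrable (fun n : ℕ => (n : ℝ)) (poissonMeasure r) := by
  rw [integrable_poissonMeasure_iff]
  simpa using (hasSum_natCast_poisson r).summable

theorem integral_natCast_poissonMeasure (r : ℝ≥0) :
    ∫ n : ℕ, (n : ℝ) ∂poissonMeasure r = r := by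
  rw [integral_poissonMeasure]
  exact (hasSum_natCast_poisson r).tsum_eq

theorem integral_pow_poissonMeasure (r : ℝ≥0) (z : ℂ) :
    ∫ n : ℕ, z ^ n ∂poissonMeasure r = Complex.exp (r * (z - 1)) := by
  rw [integral_poissonMeasure]
  have h := (NormedSpace.expSeries_div_hasSum_exp ((r : ℂ) * z)).mul_left (Complex.exp (-r))
  rw [← Complex.exp_eq_exp_ℂ, ← Complex.exp_add] at h
  rw [show (r : ℂ) * (z - 1) = -r + r * z by ring, ← h.tsum_eq]
  congr 1
  ext n
  rw [Complex.real_smul, mul_pow]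
  push_cast
  ring

variable {Ω E : Type*} {mΩ : MeasurableSpace Ω} {mE : MeasurableSpace E} {P : Measure Ω}
  {N : Ω → ℕ} {Y : ℕ → Ω → E} {r : ℝ≥0} {ν : Measure E}

/-- The marks `Y k`, `k = 0, 1, …`, are independent with law `ν`, and `N` is a Poisson number with
mean `r`, independent of the marks. -/
structure IsPoissonMarked (N : Ω → ℕ) (Y : ℕ → Ω → E) (r : ℝ≥0) (ν : Measure E)
    (P : Measure Ω) : Prop where
  measurable_count : Measurable N
  measurable_mark : ∀ k, Measurable (Y k)
  count_law : HasLaw N (poissonMeasure r) P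
  mark_law : ∀ k, HasLaw (Y k) ν P
  mark_indep : iIndepFun Y P
  count_indep : IndepFun N (fun ω k => Y k ω) P

theorem measurable_sum_range {F : Type*} [MeasurableSpace F] [AddCommMonoid F] [MeasurableAdd₂ F]
    {h : E → F} (hh : Measurable h) :
    Measurable fun p : ℕ × (ℕ → E) => ∑ k ∈ Finset.range p.1, h (p.2 k) :=
  measurable_from_prod_countable_right fun n => by
    have : ∀ k ∈ Finset.range n, Measurable fun y : ℕ → E => h (y k) :=
      fun k _ => hh.comp (measurable_pi_apply k)
    exact Finset.measurable_fun_sum _ this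

namespace IsPoissonMarked

theorem measurable_marks (H : IsPoissonMarked N Y r ν P) : Measurable fun ω k => Y k ω :=
  measurable_pi_lambda _ H.measurable_mark

theorem measurable_sum (H : IsPoissonMarked N Y r ν P) {F : Type*} [MeasurableSpace F]
    [AddCommMonoid F] [MeasurableAdd₂ F] {h : E → F} (hh : Measurable h) :
    Measurable fun ω => ∑ k ∈ Finset.range (N ω), h (Y k ω) :=
  (measurable_sum_range hh).comp (H.measurable_count.prodMk H.measurable_marks)

variable [IsProbabilityMeasure P]

theorem isProbabilityMeasure (H : IsPoissonMarked N Y r ν P) : IsProbabilityMeasure ν :=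
  (H.mark_law 0).isProbabilityMeasure_iff.1 inferInstance

theorem map_eq_prod (H : IsPoissonMarked N Y r ν P) :
    P.map (fun ω => (N ω, fun k => Y k ω)) =
      (poissonMeasure r).prod (P.map fun ω k => Y k ω) := by
  rw [(indepFun_iff_map_prod_eq_prod_map_map H.measurable_count.aemeasurable
    H.measurable_marks.aemeasurable).1 H.count_indep, H.count_law.map_eq]

/-- Conditioning on the number of marks. -/
theorem integral_eq {F : Type*} [NormedAddCommGroup F] [NormedSpace ℝ F]
    [MeasurableSpace F] [BorelSpace F] [SecondCountableTopology F]
    (H : IsPoissonMarked N Y r ν P) {f : ℕ × (ℕ → E) → F} (hf : Measurable f)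
    (hint : Integrable f ((poissonMeasure r).prod (P.map fun ω k => Y k ω))) :
    ∫ ω, f (N ω, fun k => Y k ω) ∂P =
      ∫ n, ∫ ω, f (n, fun k => Y k ω) ∂P ∂poissonMeasure r := by
  have := Measure.isProbabilityMeasure_map (μ := P) H.measurable_marks.aemeasurable
  rw [← integral_map (φ := fun ω => (N ω, fun k => Y k ω)) (f := f)
    (H.measurable_count.prodMk H.measurable_marks).aemeasurable hf.aestronglyMeasurable,
    H.map_eq_prod, integral_prod _ hint]
  refine integral_congr_ae (ae_of_all _ fun n => ?_)
  exact integral_map H.measurable_marks.aemeasurable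
    (hf.comp measurable_prodMk_left).aestronglyMeasurable

/-- The characteristic function of a compound Poisson sum. -/
theorem charFun_sum (H : IsPoissonMarked N Y r ν P) {h : E → ℝ} (hh : Measurable h) (t : ℝ) :
    charFun (P.map fun ω => ∑ k ∈ Finset.range (N ω), h (Y k ω)) t =
      Complex.exp (r * ∫ y, (Complex.exp (t * h y * Complex.I) - 1) ∂ν) := by
  have := H.isProbabilityMeasure
  have := Measure.isProbabilityMeasure_map (μ := P) H.measurable_marks.aemeasurable
  have hmeas : Measurable fun p : ℕ × (ℕ → E) =>
      Complex.exp (t * ((∑ k ∈ Finset.range p.1, h (p.2 k) : ℝ) : ℂ) * Complex.I) := by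
    have := measurable_sum_range (E := E) hh
    fun_prop
  have hbound : ∀ x : ℝ, ‖Complex.exp (t * (x : ℂ) * Complex.I)‖ ≤ 1 := fun x => by
    rw [← Complex.ofReal_mul, Complex.norm_exp_ofReal_mul_I]
  rw [charFun_apply_real, integral_map (H.measurable_sum hh).aemeasurable (by fun_prop)]
  rw [H.integral_eq (f := fun p : ℕ × (ℕ → E) =>
      Complex.exp (t * ((∑ k ∈ Finset.range p.1, h (p.2 k) : ℝ) : ℂ) * Complex.I)) hmeas
    (Integrable.of_bound hmeas.aestronglyMeasurable 1 (ae_of_all _ fun p => hbound _))]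
  have hφ : ∫ y, (Complex.exp (t * h y * Complex.I) - 1) ∂ν = charFun (ν.map h) t - 1 := by
    rw [integral_sub (Integrable.of_bound (by fun_prop) 1 (ae_of_all _ fun y => hbound _))
      (integrable_const _), charFun_apply_real, integral_map hh.aemeasurable (by fun_prop)]
    simp
  rw [hφ, ← integral_pow_poissonMeasure]
  refine integral_congr_ae (ae_of_all _ fun n => ?_)
  have hm : ∀ k, Measurable fun ω => h (Y k ω) := fun k => hh.comp (H.measurable_mark k)
  have hind : iIndepFun (fun k ω => h (Y k ω)) P := H.mark_indep.comp (fun _ => h) fun _ => hh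
  have := congrFun ((hind.restrict (Finset.range n)).charFun_map_fun_finsetSum_eq_prod
    fun k _ => (hm k).aemeasurable) t
  rw [charFun_apply_real, integral_map
    (Finset.measurable_fun_sum _ fun k _ => hm k).aemeasurable (by fun_prop)] at this
  refine this.trans ?_
  rw [Finset.prod_apply, Finset.prod_congr rfl (g := fun _ => charFun (ν.map h) t),
    Finset.prod_const, Finset.card_range]
  intro k _
  rw [← (H.mark_law k).map_eq, Measure.map_map hh (H.measurable_mark k)]
  rfl

theorem charFunDual_sum (H : IsPoissonMarked N Y r ν P) {F : Type*} [NormedAddCommGroup F]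
    [NormedSpace ℝ F] [MeasurableSpace F] [BorelSpace F] [SecondCountableTopology F] {h : E → F}
    (hh : Measurable h) (L : StrongDual ℝ F) :
    charFunDual (P.map fun ω => ∑ k ∈ Finset.range (N ω), h (Y k ω)) L =
      Complex.exp (r * ∫ y, (Complex.exp (L (h y) * Complex.I) - 1) ∂ν) := by
  rw [charFunDual_eq_charFun_map_one, Measure.map_map (by fun_prop) (H.measurable_sum hh)]
  have := H.charFun_sum (h := fun y => L (h y)) (by fun_prop) 1
  simp only [Complex.ofReal_one, one_mul] at this
  rw [← this]
  congr 2
  ext ω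
  simp

theorem integrable_sum_prod (H : IsPoissonMarked N Y r ν P) {h : E → ℝ} (hh : Measurable h)
    (hint : Integrable h ν) :
    Integrable (fun p : ℕ × (ℕ → E) => ∑ k ∈ Finset.range p.1, h (p.2 k))
      ((poissonMeasure r).prod (P.map fun ω k => Y k ω)) := by
  have := Measure.isProbabilityMeasure_map (μ := P) H.measurable_marks.aemeasurable
  have hk : ∀ k, Integrable (fun y : ℕ → E => h (y k)) (P.map fun ω k => Y k ω) := fun k => by
    have h1 : Integrable h (P.map (Y k)) := by rwa [(H.mark_law k).map_eq]
    have hm : Measurable fun y : ℕ → E => h (y k) := hh.comp (measurable_pi_apply k)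
    rw [integrable_map_measure hm.aestronglyMeasurable H.measurable_marks.aemeasurable]
    exact h1.comp_measurable (H.measurable_mark k)
  have hval : ∀ k, ∫ y : ℕ → E, ‖h (y k)‖ ∂(P.map fun ω k => Y k ω) = ∫ y, ‖h y‖ ∂ν := fun k => by
    have hm : Measurable fun y : ℕ → E => ‖h (y k)‖ := (hh.comp (measurable_pi_apply k)).norm
    rw [integral_map H.measurable_marks.aemeasurable hm.aestronglyMeasurable,
      ← (H.mark_law k).map_eq,
      integral_map (H.measurable_mark k).aemeasurable hh.norm.aestronglyMeasurable]
  rw [integrable_prod_iff (measurable_sum_range hh).aestronglyMeasurable]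
  refine ⟨ae_of_all _ fun n => integrable_finsetSum (Finset.range n) fun k _ => hk k, ?_⟩
  refine ((integrable_natCast_poissonMeasure r).mul_const (∫ y, ‖h y‖ ∂ν)).mono'
    Measurable.of_discrete.aestronglyMeasurable (ae_of_all _ fun n => ?_)
  rw [Real.norm_of_nonneg (integral_nonneg fun _ => norm_nonneg _)]
  calc _ ≤ ∫ y : ℕ → E, ∑ k ∈ Finset.range n, ‖h (y k)‖ ∂(P.map fun ω k => Y k ω) :=
        integral_mono (integrable_finsetSum _ fun k _ => hk k).norm
          (integrable_finsetSum _ fun k _ => (hk k).norm) fun y => norm_sum_le _ _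
    _ = n * ∫ y, ‖h y‖ ∂ν := by
        rw [integral_finsetSum _ fun k _ => (hk k).norm]
        simp only [hval]
        simp

theorem integrable_sum (H : IsPoissonMarked N Y r ν P) {h : E → ℝ} (hh : Measurable h)
    (hint : Integrable h ν) : Integrable (fun ω => ∑ k ∈ Finset.range (N ω), h (Y k ω)) P := by
  have := H.integrable_sum_prod hh hint
  rw [← H.map_eq_prod] at this
  exact this.comp_measurable (H.measurable_count.prodMk H.measurable_marks)

/-- Wald's identity for a compound Poisson sum. -/
theorem integral_sum (H : IsPoissonMarked N Y r ν P) {h : E → ℝ} (hh : Measurable h)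
    (hint : Integrable h ν) :
    ∫ ω, ∑ k ∈ Finset.range (N ω), h (Y k ω) ∂P = r * ∫ y, h y ∂ν := by
  rw [H.integral_eq (measurable_sum_range hh) (H.integrable_sum_prod hh hint),
    ← integral_natCast_poissonMeasure r, ← integral_mul_const]
  refine integral_congr_ae (ae_of_all _ fun n => ?_)
  have hval : ∀ k, ∫ ω, h (Y k ω) ∂P = ∫ y, h y ∂ν := fun k => by
    rw [← (H.mark_law k).map_eq, integral_map (H.measurable_mark k).aemeasurable
      hh.aestronglyMeasurable]
  have hk : ∀ k, Integrable (fun ω => h (Y k ω)) P := fun k => by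
    have h1 : Integrable h (P.map (Y k)) := by rwa [(H.mark_law k).map_eq]
    exact h1.comp_measurable (H.measurable_mark k)
  simp only
  rw [integral_finsetSum _ fun k _ => hk k]
  simp [hval]

/-- Poisson thinning: sums over marks of disjoint types are independent, because the exponent of
the joint characteristic function splits. -/
theorem indepFun_sum (H : IsPoissonMarked N Y r ν P) {κ : Type*} [Fintype κ] {h : E → ℝ}
    {g : E → κ → ℝ} (hh : Measurable h) (hg : Measurable g) (hdisj : ∀ y, h y = 0 ∨ g y = 0) :
    IndepFun (fun ω => ∑ k ∈ Finset.range (N ω), h (Y k ω))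
      (fun ω => ∑ k ∈ Finset.range (N ω), g (Y k ω)) P := by
  have := H.isProbabilityMeasure
  rw [indepFun_iff_charFunDual_prod (H.measurable_sum hh).aemeasurable
    (H.measurable_sum hg).aemeasurable]
  intro L
  have hpair : (fun ω => (∑ k ∈ Finset.range (N ω), h (Y k ω), ∑ k ∈ Finset.range (N ω), g (Y k ω)))
      = fun ω => ∑ k ∈ Finset.range (N ω), (h (Y k ω), g (Y k ω)) := by
    ext1 ω
    simp [Prod.ext_iff, Prod.fst_sum, Prod.snd_sum]
  have hb : ∀ f : E → ℝ, Measurable f →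
      Integrable (fun y => Complex.exp (f y * Complex.I) - 1) ν := fun f hf =>
    (Integrable.of_bound (by fun_prop) 1
      (ae_of_all _ fun y => (Complex.norm_exp_ofReal_mul_I _).le)).sub (integrable_const _)
  rw [hpair, H.charFunDual_sum (hh.prodMk hg), H.charFunDual_sum hh, H.charFunDual_sum hg,
    ← Complex.exp_add, ← mul_add, ← integral_add (hb _ (by fun_prop)) (hb _ (by fun_prop))]
  congr 2
  refine integral_congr_ae (ae_of_all _ fun y => ?_)
  -- One of the two components of a mark vanishes, so one of the two integrands is zero.
  have hL0 : L (0, 0) = 0 := L.map_zero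
  rcases hdisj y with h0 | h0 <;> simp [h0, hL0]

end IsPoissonMarked

end CompoundPoisson

/-! ### Central limit theorem for compound Poisson sums -/

section CLT

/-- A bound valid for all real `x`; it provides the integrable majorant `h²` in the central limit
theorem. -/
theorem norm_exp_mul_I_sub_one_sub_le (x : ℝ) :
    ‖Complex.exp (x * Complex.I) - 1 - x * Complex.I‖ ≤ 2 * x ^ 2 := by
  rcases le_total |x| 1 with hx | hx
  · have h := Complex.norm_exp_sub_one_sub_id_le (x := x * Complex.I) (by simpa using hx)
    simp only [norm_mul, Complex.norm_real, Complex.norm_I, mul_one, Real.norm_eq_abs, sq_abs] at h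
    nlinarith [sq_nonneg x]
  · have h1 : ‖Complex.exp (x * Complex.I) - 1‖ ≤ |x| := by
      have := Real.norm_exp_I_mul_ofReal_sub_one_le (x := x)
      rwa [mul_comm, Real.norm_eq_abs] at this
    have h2 := norm_sub_le (Complex.exp (x * Complex.I) - 1) (x * Complex.I)
    simp only [norm_mul, Complex.norm_real, Complex.norm_I, mul_one, Real.norm_eq_abs] at h2
    nlinarith [sq_abs x]

/-- The second order term of the exponential series. -/
theorem tendsto_inv_sq_mul_exp_mul_I_sub (x : ℝ) :
    Tendsto (fun s : ℝ => ((s ^ 2)⁻¹ : ℂ) *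
      (Complex.exp ((s * x : ℝ) * Complex.I) - 1 - (s * x : ℝ) * Complex.I))
      (𝓝[>] 0) (𝓝 (-(x ^ 2 / 2 : ℝ))) := by
  have hev : ∀ᶠ s : ℝ in 𝓝[>] 0, |s * x| ≤ 1 := by
    have : Tendsto (fun s : ℝ => |s * x|) (𝓝[>] 0) (𝓝 0) := by
      have : Tendsto (fun s : ℝ => |s * x|) (𝓝 0) (𝓝 |0 * x|) :=
        Continuous.tendsto (by fun_prop) _
      simpa using this.mono_left nhdsWithin_le_nhds
    exact (this.eventually_lt_const one_pos).mono fun _ => le_of_lt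
  rw [tendsto_iff_norm_sub_tendsto_zero]
  have hlim : Tendsto (fun s : ℝ => s * |x| ^ 3) (𝓝[>] 0) (𝓝 0) := by
    have : Tendsto (fun s : ℝ => s * |x| ^ 3) (𝓝 0) (𝓝 (0 * |x| ^ 3)) :=
      Continuous.tendsto (by fun_prop) _
    simpa using this.mono_left nhdsWithin_le_nhds
  refine tendsto_of_tendsto_of_tendsto_of_le_of_le' tendsto_const_nhds hlim
    (Eventually.of_forall fun _ => norm_nonneg _) ?_
  filter_upwards [hev, self_mem_nhdsWithin] with s hs hs0
  have hs0 : 0 < s := hs0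
  have hb := Complex.exp_bound (x := (s * x : ℝ) * Complex.I) (by simpa using hs) (n := 3)
    (by norm_num)
  have hsum : ∑ m ∈ Finset.range 3, ((s * x : ℝ) * Complex.I) ^ m / (m.factorial : ℂ) =
      1 + (s * x : ℝ) * Complex.I - ((s * x) ^ 2 / 2 : ℝ) := by
    simp only [Finset.sum_range_succ, Finset.sum_range_zero, mul_pow, Complex.I_sq]
    simp [Nat.factorial]
    ring
  rw [hsum] at hb
  have hs' : (s : ℂ) ≠ 0 := by exact_mod_cast hs0.ne'
  have hrew : ((s ^ 2)⁻¹ : ℂ) *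
      (Complex.exp ((s * x : ℝ) * Complex.I) - 1 - (s * x : ℝ) * Complex.I) - -(x ^ 2 / 2 : ℝ) =
      ((s ^ 2)⁻¹ : ℂ) * (Complex.exp ((s * x : ℝ) * Complex.I) -
        (1 + (s * x : ℝ) * Complex.I - ((s * x) ^ 2 / 2 : ℝ))) := by
    push_cast
    field_simp
    ring
  rw [hrew, norm_mul, norm_inv, norm_pow, Complex.norm_real, Real.norm_of_nonneg hs0.le]
  have h3 : ‖((s * x : ℝ) : ℂ) * Complex.I‖ = s * |x| := by
    rw [norm_mul, Complex.norm_I, mul_one, Complex.norm_real, Real.norm_eq_abs, abs_mul,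
      abs_of_pos hs0]
  rw [h3] at hb
  have hc : ((Nat.succ 3 : ℕ) : ℝ) * ((Nat.factorial 3 * (3 : ℕ) : ℕ) : ℝ)⁻¹ ≤ 1 := by
    norm_num [Nat.factorial]
  calc (s ^ 2)⁻¹ * _ ≤ (s ^ 2)⁻¹ * ((s * |x|) ^ 3 * 1) := by
        gcongr
        refine hb.trans ?_
        gcongr
        exact_mod_cast hc
    _ = s * |x| ^ 3 := by field_simp

variable {E : Type*} {mE : MeasurableSpace E} {ν : Measure E}

/-- The exponent of the centred compound Poisson sum, scaled by `s = α^{-1/2}`, converges to the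
exponent of a centred normal law. -/
theorem tendsto_inv_sq_mul_integral_exp_sub [IsFiniteMeasure ν] {h : E → ℝ} (hh : Measurable h)
    (hL : MemLp h 2 ν) (t : ℝ) :
    Tendsto (fun s : ℝ => ((s ^ 2)⁻¹ : ℂ) *
      ∫ y, (Complex.exp ((s * (t * h y) : ℝ) * Complex.I) - 1 - (s * (t * h y) : ℝ) * Complex.I) ∂ν)
      (𝓝[>] 0) (𝓝 (-(t ^ 2 / 2 * ∫ y, h y ^ 2 ∂ν : ℝ))) := by
  have hlim : (-(t ^ 2 / 2 * ∫ y, h y ^ 2 ∂ν : ℝ) : ℂ) =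
      ∫ y, (-((t * h y) ^ 2 / 2 : ℝ) : ℂ) ∂ν := by
    rw [integral_neg, integral_complex_ofReal, ← integral_const_mul]
    congr 3
    ext y
    ring
  rw [hlim]
  simp_rw [← integral_const_mul]
  refine tendsto_integral_filter_of_dominated_convergence (fun y => 2 * t ^ 2 * h y ^ 2)
    (Eventually.of_forall fun s => by fun_prop) ?_ (hL.integrable_sq.const_mul _)
    (ae_of_all _ fun y => tendsto_inv_sq_mul_exp_mul_I_sub _)
  filter_upwards [self_mem_nhdsWithin] with s hs0
  have hs0 : 0 < s := hs0
  refine ae_of_all _ fun y => ?_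
  rw [norm_mul, norm_inv, norm_pow, Complex.norm_real, Real.norm_of_nonneg hs0.le]
  calc (s ^ 2)⁻¹ * _ ≤ (s ^ 2)⁻¹ * (2 * (s * (t * h y)) ^ 2) := by
        gcongr
        exact norm_exp_mul_I_sub_one_sub_le _
    _ = 2 * t ^ 2 * h y ^ 2 := by field_simp

theorem tendsto_rpow_neg_half :
    Tendsto (fun α : ℝ≥0 => (α : ℝ) ^ (-(1 / 2) : ℝ)) atTop (𝓝[>] 0) := by
  refine tendsto_nhdsWithin_iff.2 ⟨?_, ?_⟩
  · exact (tendsto_rpow_neg_atTop (by norm_num)).comp (NNReal.tendsto_coe_atTop.2 tendsto_id)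
  · filter_upwards [eventually_gt_atTop 0] with α hα
    exact Real.rpow_pos_of_pos (by exact_mod_cast hα) _

variable {Ω ι : Type*} {mΩ : MeasurableSpace Ω} {P : Measure Ω} [IsProbabilityMeasure P]

/-- The characteristic function of a centred and scaled compound Poisson sum. -/
theorem IsPoissonMarked.charFun_centered {N : Ω → ℕ} {Y : ℕ → Ω → E} {r : ℝ≥0}
    (H : IsPoissonMarked N Y r ν P) {h : E → ℝ} (hh : Measurable h) (hint : Integrable h ν)
    (s t : ℝ) :
    charFun (P.map fun ω => s * (∑ k ∈ Finset.range (N ω), h (Y k ω) - r * ∫ y, h y ∂ν)) t =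
      Complex.exp (r * ∫ y, (Complex.exp ((s * (t * h y) : ℝ) * Complex.I) - 1 -
        (s * (t * h y) : ℝ) * Complex.I) ∂ν) := by
  have := H.isProbabilityMeasure
  have hm := H.measurable_sum hh
  have h1 := H.charFun_sum hh (s * t)
  rw [charFun_apply_real, integral_map hm.aemeasurable (by fun_prop)] at h1
  rw [charFun_apply_real, integral_map ((hm.sub_const _).const_mul s).aemeasurable (by fun_prop)]
  have hsplit : ∀ ω, Complex.exp (t * ((s * (∑ k ∈ Finset.range (N ω), h (Y k ω)
      - r * ∫ y, h y ∂ν) : ℝ) : ℂ) * Complex.I) =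
      Complex.exp ((s * t : ℝ) * ((∑ k ∈ Finset.range (N ω), h (Y k ω) : ℝ) : ℂ) * Complex.I) *
        Complex.exp (-(r * (s * (t * ∫ y, h y ∂ν) : ℝ) * Complex.I)) := fun ω => by
    rw [← Complex.exp_add]
    congr 1
    push_cast
    ring
  simp_rw [hsplit]
  rw [integral_mul_const, h1, ← Complex.exp_add]
  congr 1
  have hi1 : Integrable (fun y => Complex.exp ((s * (t * h y) : ℝ) * Complex.I) - 1) ν :=
    (Integrable.of_bound (by fun_prop) 1
      (ae_of_all _ fun y => (Complex.norm_exp_ofReal_mul_I _).le)).sub (integrable_const _)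
  have hi2 : Integrable (fun y => ((s * (t * h y) : ℝ) : ℂ) * Complex.I) ν :=
    ((hint.const_mul t).const_mul s).ofReal.mul_const _
  rw [integral_sub hi1 hi2, integral_mul_const, integral_complex_ofReal, integral_const_mul,
    integral_const_mul, mul_sub, sub_eq_add_neg]
  congr 1
  · congr 2
    ext y
    congr 3
    push_cast
    ring
  · ring

/-- Central limit theorem for finitely many independent compound Poisson sums whose intensities
grow linearly. -/
theorem tendstoInDistribution_compoundPoisson {N : ι → ℝ≥0 → Ω → ℕ} {Y : ι → ℕ → Ω → E}
    {lam : ι → ℝ≥0} {J : Finset ι} {h : ι → E → ℝ}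
    (H : ∀ j ∈ J, ∀ α, IsPoissonMarked (N j α) (Y j) (lam j * α) ν P)
    (hind : ∀ α, iIndepFun
      (fun (j : J) ω => ∑ k ∈ Finset.range (N j α ω), h j (Y j k ω)) P)
    (hh : ∀ j ∈ J, Measurable (h j)) (hL : ∀ j ∈ J, MemLp (h j) 2 ν) {v : ℝ≥0}
    (hv : (v : ℝ) = ∑ j ∈ J, lam j * ∫ y, h j y ^ 2 ∂ν) :
    TendstoInDistribution (fun (α : ℝ≥0) ω => (α : ℝ) ^ (-(1 / 2) : ℝ) *
      ∑ j ∈ J, (∑ k ∈ Finset.range (N j α ω), h j (Y j k ω) - lam j * α * ∫ y, h j y ∂ν))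
      atTop (id : ℝ → ℝ) (fun _ => P) (gaussianReal 0 v) := by
  have hm : ∀ j ∈ J, ∀ α, Measurable fun ω => ∑ k ∈ Finset.range (N j α ω), h j (Y j k ω) :=
    fun j hj α => (H j hj α).measurable_sum (hh j hj)
  have hm' : ∀ j ∈ J, ∀ α : ℝ≥0, Measurable fun ω => (α : ℝ) ^ (-(1 / 2) : ℝ) *
      (∑ k ∈ Finset.range (N j α ω), h j (Y j k ω) - (lam j * α : ℝ≥0) * ∫ y, h j y ∂ν) :=
    fun j hj α => ((hm j hj α).sub_const _).const_mul _
  have hsum : ∀ (α : ℝ≥0) ω, (α : ℝ) ^ (-(1 / 2) : ℝ) *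
      ∑ j ∈ J, (∑ k ∈ Finset.range (N j α ω), h j (Y j k ω) - lam j * α * ∫ y, h j y ∂ν) =
      ∑ j ∈ J, (α : ℝ) ^ (-(1 / 2) : ℝ) *
        (∑ k ∈ Finset.range (N j α ω), h j (Y j k ω) - (lam j * α : ℝ≥0) * ∫ y, h j y ∂ν) :=
    fun α ω => by rw [Finset.mul_sum]; push_cast; rfl
  simp_rw [hsum]
  refine tendstoInDistribution_of_tendsto_charFun
    (fun α => (Finset.measurable_fun_sum _ fun j hj => hm' j hj α).aemeasurable) fun t => ?_
  have hchar : ∀ α : ℝ≥0, charFun (P.map fun ω => ∑ j ∈ J, (α : ℝ) ^ (-(1 / 2) : ℝ) *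
        (∑ k ∈ Finset.range (N j α ω), h j (Y j k ω) - (lam j * α : ℝ≥0) * ∫ y, h j y ∂ν)) t =
      ∏ j ∈ J, Complex.exp ((lam j * α : ℝ≥0) *
        ∫ y, (Complex.exp (((α : ℝ) ^ (-(1 / 2) : ℝ) * (t * h j y) : ℝ) * Complex.I) - 1 -
        ((α : ℝ) ^ (-(1 / 2) : ℝ) * (t * h j y) : ℝ) * Complex.I) ∂ν) := fun α => by
    have hi : iIndepFun (J.restrict fun j ω => (α : ℝ) ^ (-(1 / 2) : ℝ) *
        (∑ k ∈ Finset.range (N j α ω), h j (Y j k ω) - (lam j * α : ℝ≥0) * ∫ y, h j y ∂ν)) P :=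
      (hind α).comp (fun (j : J) x => (α : ℝ) ^ (-(1 / 2) : ℝ) *
        (x - (lam j * α : ℝ≥0) * ∫ y, h j y ∂ν)) fun j => by fun_prop
    rw [hi.charFun_map_fun_finsetSum_eq_prod fun j hj => (hm' j hj α).aemeasurable,
      Finset.prod_apply]
    refine Finset.prod_congr rfl fun j hj => ?_
    have := (H j hj α).isProbabilityMeasure
    exact (H j hj α).charFun_centered (hh j hj) ((hL j hj).integrable (by norm_num)) _ t
  simp_rw [hchar]
  have hlim : charFun (gaussianReal 0 v) t =
      ∏ j ∈ J, Complex.exp (lam j * (-(t ^ 2 / 2 * ∫ y, h j y ^ 2 ∂ν : ℝ))) := by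
    rw [charFun_gaussianReal, ← Complex.exp_sum]
    congr 1
    have : ((v : ℝ) : ℂ) = ∑ j ∈ J, lam j * ((∫ y, h j y ^ 2 ∂ν : ℝ) : ℂ) := by
      rw [hv]; push_cast; rfl
    rw [this, Finset.sum_mul, Finset.sum_div]
    simp only [Complex.ofReal_zero, mul_zero, zero_mul, zero_sub, ← Finset.sum_neg_distrib]
    refine Finset.sum_congr rfl fun j _ => ?_
    push_cast
    ring
  rw [hlim]
  refine tendsto_finsetProd _ fun j hj => (Complex.continuous_exp.tendsto _).comp ?_
  have := (H j hj 0).isProbabilityMeasure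
  have h0 := (((tendsto_inv_sq_mul_integral_exp_sub (hh j hj) (hL j hj) t).comp
    tendsto_rpow_neg_half).const_mul (lam j : ℂ))
  refine h0.congr' ?_
  filter_upwards [eventually_gt_atTop 0] with α hα
  have hα' : (0 : ℝ) < α := by exact_mod_cast hα
  have hsq : (((α : ℝ) ^ (-(1 / 2) : ℝ)) ^ 2)⁻¹ = α := by
    rw [← Real.rpow_natCast, ← Real.rpow_mul hα'.le]
    norm_num [Real.rpow_neg_one]
  simp only [Function.comp_apply]
  rw [← Complex.ofReal_pow, ← Complex.ofReal_inv, hsq, ← mul_assoc]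
  push_cast
  rfl

end CLT

/-! ### The model: moments, marked Poisson sums and independence of the years -/

/-- The contribution of a claim `p = (development year, size)` to the claims amount accumulated
up to development year `t`. -/
noncomputable def weight (t : ℕ) (p : ℕ × ℝ) : ℝ := if p.1 ≤ t then p.2 else 0

/-- `E[Z 1{D ≤ t}]`. -/
noncomputable def cumMean (ν : Measure (ℕ × ℝ)) (t : ℕ) : ℝ := ∫ p, weight t p ∂ν

/-- The whole randomness of an accident year: its counting process and its claims. -/
def yearData {Ω : Type*} (D : ℕ → ℕ → Ω → ℕ) (Z : ℕ → ℕ → Ω → ℝ) (M : ℕ → ℝ≥0 → Ω → ℕ) (j : ℕ)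
    (ω : Ω) : (ℝ≥0 → ℕ) × (ℕ → ℕ × ℝ) :=
  (fun α => M j α ω, fun k => (D j k ω, Z j k ω))

/-- The sum of `h` over the claims of an accident year at exposure `α`, as a function of the data
of that year. -/
def aggregate {F : Type*} [AddCommMonoid F] (h : ℕ × ℝ → F) (α : ℝ≥0)
    (x : (ℝ≥0 → ℕ) × (ℕ → ℕ × ℝ)) : F :=
  ∑ k ∈ Finset.range (x.1 α), h (x.2 k)

theorem measurable_weight (t : ℕ) : Measurable (weight t) :=
  Measurable.ite (measurableSet_le measurable_fst measurable_const) measurable_snd measurable_const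

theorem measurable_aggregate {F : Type*} [MeasurableSpace F] [AddCommMonoid F]
    [MeasurableAdd₂ F] {h : ℕ × ℝ → F} (hh : Measurable h) (α : ℝ≥0) :
    Measurable (aggregate h α) := by
  have h1 : Measurable fun x : (ℝ≥0 → ℕ) × (ℕ → ℕ × ℝ) => (x.1 α, x.2) := by fun_prop
  exact (measurable_sum_range hh).comp h1

theorem devFactor_eq (ν : Measure (ℕ × ℝ)) (t : ℕ) :
    devFactor ν t = cumMean ν (t + 1) / cumMean ν t := rfl

theorem accClaims_eq_aggregate {Ω : Type*} (D : ℕ → ℕ → Ω → ℕ) (Z : ℕ → ℕ → Ω → ℝ)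
    (M : ℕ → ℝ≥0 → Ω → ℕ) (j t : ℕ) (α : ℝ≥0) :
    accClaims D Z M j t α = fun ω => aggregate (weight t) α (yearData D Z M j ω) := rfl

section Model

variable {Ω : Type*} [MeasurableSpace Ω] {P : Measure Ω} {T : ℕ} {lam : ℕ → ℝ≥0}
  {ν : Measure (ℕ × ℝ)} {D : ℕ → ℕ → Ω → ℕ} {Z : ℕ → ℕ → Ω → ℝ} {M : ℕ → ℝ≥0 → Ω → ℕ}

namespace IsSpecialModel

theorem measurable_yearData (hm : IsSpecialModel P T lam ν D Z M) {j : ℕ}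
    (hj : j ∈ Finset.Icc 1 T) : Measurable (yearData D Z M j) :=
  (measurable_pi_lambda _ (hm.poisson j hj).measurable).prodMk
    (measurable_pi_lambda _ fun k => (hm.measurable_D j hj k).prodMk (hm.measurable_Z j hj k))

theorem measurable_accClaims (hm : IsSpecialModel P T lam ν D Z M) {j : ℕ}
    (hj : j ∈ Finset.Icc 1 T) (t : ℕ) (α : ℝ≥0) : Measurable (accClaims D Z M j t α) :=
  (measurable_aggregate (measurable_weight t) α).comp (hm.measurable_yearData hj)

theorem isPoissonMarked (hm : IsSpecialModel P T lam ν D Z M) {j : ℕ} (hj : j ∈ Finset.Icc 1 T)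
    (α : ℝ≥0) :
    IsPoissonMarked (M j α) (fun k ω => (D j k ω, Z j k ω)) (lam j * α) ν P where
  measurable_count := (hm.poisson j hj).measurable α
  measurable_mark k := (hm.measurable_D j hj k).prodMk (hm.measurable_Z j hj k)
  count_law := by
    have h := (hm.poisson j hj).increment_law 0 α zero_le
    rw [tsub_zero] at h
    refine h.congr ?_
    filter_upwards [(hm.poisson j hj).start_zero] with ω hω
    simp [hω]
  mark_law := hm.pair_law j hj
  mark_indep := hm.pair_indep j hj
  count_indep := (hm.count_indep_claims j hj).comp (measurable_pi_apply α) measurable_id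

/-- The sums over the claims of different accident years are independent. -/
theorem iIndepFun_aggregate (hm : IsSpecialModel P T lam ν D Z M) {J : Finset ℕ}
    (hJ : J ⊆ Finset.Icc 1 T) {h : ℕ → ℕ × ℝ → ℝ} (hh : ∀ j ∈ J, Measurable (h j)) (α : ℝ≥0) :
    iIndepFun (fun (j : J) ω => aggregate (h j) α (yearData D Z M j ω)) P := by
  have h0 : iIndepFun (fun j : Finset.Icc 1 T => yearData D Z M j) P := hm.years_indep
  have hinj : Function.Injective fun j : J => (⟨j.1, hJ j.2⟩ : Finset.Icc 1 T) :=
    fun a b hab => by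
      simp only [Subtype.mk.injEq] at hab
      exact Subtype.ext hab
  have h1 : iIndepFun (fun (j : J) => yearData D Z M j) P := h0.precomp hinj
  exact h1.comp (fun (j : J) => aggregate (h j) α) fun j => measurable_aggregate (hh j j.2) α

/-- The data of the accident years other than `i` are independent of the data of year `i`. -/
theorem indepFun_yearData (hm : IsSpecialModel P T lam ν D Z M) {i : ℕ}
    (hi : i ∈ Finset.Icc 1 T) :
    IndepFun (yearData D Z M i)
      (fun ω (j : (Finset.univ.erase (⟨i, hi⟩ : Finset.Icc 1 T) : Finset (Finset.Icc 1 T))) =>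
        yearData D Z M j.1 ω) P := by
  have h := hm.years_indep.indepFun_finset {(⟨i, hi⟩ : Finset.Icc 1 T)}
    (Finset.univ.erase (⟨i, hi⟩ : Finset.Icc 1 T)) (by simp)
    (fun j => hm.measurable_yearData j.2)
  exact h.comp (measurable_pi_apply (⟨⟨i, hi⟩, Finset.mem_singleton_self _⟩ :
    ({(⟨i, hi⟩ : Finset.Icc 1 T)} : Finset (Finset.Icc 1 T)))) measurable_id

theorem memLp_of_le_size (hm : IsSpecialModel P T lam ν D Z M) {h : ℕ × ℝ → ℝ}
    (hh : Measurable h) (hle : ∀ p, |h p| ≤ |p.2|) : MemLp h 2 ν :=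
  hm.second_moment.mono hh.aestronglyMeasurable (ae_of_all _ hle)

theorem memLp_weight (hm : IsSpecialModel P T lam ν D Z M) (t : ℕ) : MemLp (weight t) 2 ν :=
  hm.memLp_of_le_size (measurable_weight t) fun p => by
    unfold weight
    split_ifs <;> simp

theorem cumMean_zero (hm : IsSpecialModel P T lam ν D Z M) : cumMean ν 0 = 0 := by
  refine integral_eq_zero_of_ae ?_
  filter_upwards [hm.development_year] with p hp
  have := (Finset.mem_Icc.1 hp).1
  simp [weight, show ¬p.1 ≤ 0 by omega]

variable [IsProbabilityMeasure P]

theorem isProbabilityMeasure (hm : IsSpecialModel P T lam ν D Z M) (hT : 1 ≤ T) :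
    IsProbabilityMeasure ν :=
  (hm.isPoissonMarked (Finset.mem_Icc.2 ⟨le_rfl, hT⟩) 0).isProbabilityMeasure

theorem integrable_weight (hm : IsSpecialModel P T lam ν D Z M) (hT : 1 ≤ T) (t : ℕ) :
    Integrable (weight t) ν :=
  have := hm.isProbabilityMeasure hT
  (hm.memLp_weight t).integrable (by norm_num)

theorem cumMean_lt_succ (hm : IsSpecialModel P T lam ν D Z M) {t : ℕ} (ht : t < T) :
    cumMean ν t < cumMean ν (t + 1) := by
  have hT : 1 ≤ T := by omega
  have hpos := hm.mean_pos (t + 1) (Finset.mem_Icc.2 ⟨by omega, ht⟩)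
  have hsub : cumMean ν (t + 1) - cumMean ν t = ∫ p, (if p.1 = t + 1 then p.2 else 0) ∂ν := by
    rw [cumMean, cumMean, ← integral_sub (hm.integrable_weight hT _) (hm.integrable_weight hT _)]
    refine integral_congr_ae (ae_of_all _ fun p => ?_)
    simp only [weight]
    split_ifs <;> first | omega | simp
  linarith

theorem cumMean_lt (hm : IsSpecialModel P T lam ν D Z M) {s t : ℕ} (hst : s < t) (ht : t ≤ T) :
    cumMean ν s < cumMean ν t := by
  induction t, hst using Nat.le_induction with
  | base => exact hm.cumMean_lt_succ (by omega)
  | succ t _ ih => exact (ih (by omega)).trans (hm.cumMean_lt_succ (by omega))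

theorem cumMean_pos (hm : IsSpecialModel P T lam ν D Z M) {t : ℕ} (ht : t ∈ Finset.Icc 1 T) :
    0 < cumMean ν t := by
  rw [← hm.cumMean_zero]
  exact hm.cumMean_lt (Finset.mem_Icc.1 ht).1 (Finset.mem_Icc.1 ht).2

theorem devFactor_pos (hm : IsSpecialModel P T lam ν D Z M) {t : ℕ} (h1 : 1 ≤ t) (ht : t < T) :
    0 < devFactor ν t :=
  div_pos (hm.cumMean_pos (Finset.mem_Icc.2 ⟨by omega, ht⟩))
    (hm.cumMean_pos (Finset.mem_Icc.2 ⟨h1, ht.le⟩))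

/-- The product of the development factors telescopes. -/
theorem factorProd_eq (hm : IsSpecialModel P T lam ν D Z M) {i : ℕ} (hi : i ∈ Finset.Icc 1 T) :
    factorProd T ν i = cumMean ν T / cumMean ν (T - i + 1) := by
  obtain ⟨h1, h2⟩ := Finset.mem_Icc.1 hi
  have key : ∀ n, T - i + 1 ≤ n → n ≤ T →
      ∏ s ∈ Finset.Ico (T - i + 1) n, devFactor ν s = cumMean ν n / cumMean ν (T - i + 1) := by
    intro n hn
    induction n, hn using Nat.le_induction with
    | base =>
      intro hT
      have := hm.cumMean_pos (Finset.mem_Icc.2 ⟨Nat.succ_le_succ (zero_le (a := T - i)), hT⟩)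
      simp [div_self this.ne']
    | succ n hn ih =>
      intro hT
      have := hm.cumMean_pos (Finset.mem_Icc.2 ⟨(by omega : 1 ≤ n), by omega⟩)
      rw [Finset.prod_Ico_succ_top hn, ih (by omega), devFactor_eq]
      field_simp
  exact key T (by omega) le_rfl

/-- The central limit theorem for sums over the claims of several accident years. -/
theorem tendstoInDistribution_aggregate (hm : IsSpecialModel P T lam ν D Z M) {J : Finset ℕ}
    (hJ : J ⊆ Finset.Icc 1 T) {h : ℕ → ℕ × ℝ → ℝ} (hh : ∀ j ∈ J, Measurable (h j))
    (hL : ∀ j ∈ J, MemLp (h j) 2 ν) {v : ℝ≥0}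
    (hv : (v : ℝ) = ∑ j ∈ J, lam j * ∫ p, h j p ^ 2 ∂ν) :
    TendstoInDistribution (fun (α : ℝ≥0) ω => (α : ℝ) ^ (-(1 / 2) : ℝ) *
      ∑ j ∈ J, (aggregate (h j) α (yearData D Z M j ω) - lam j * α * ∫ p, h j p ∂ν))
      atTop (id : ℝ → ℝ) (fun _ => P) (gaussianReal 0 v) :=
  tendstoInDistribution_compoundPoisson
    (fun _ hj α => hm.isPoissonMarked (hJ hj) α) (hm.iIndepFun_aggregate hJ hh) hh hL hv

end IsSpecialModel

end Model

/-! ### The conditional expectation of the prediction error -/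

section PredictionError

/-- If `X` and `Y` are independent, and `W` is independent of `(X, Y)`, then `X` is independent of
`(Y, W)`. -/
theorem indepFun_prodMk_of_indepFun_prodMk {Ω A B C : Type*} [MeasurableSpace Ω]
    [MeasurableSpace A] [MeasurableSpace B] [MeasurableSpace C] {P : Measure Ω}
    [IsProbabilityMeasure P] {X : Ω → A} {Y : Ω → B} {W : Ω → C} (hX : Measurable X)
    (hY : Measurable Y) (hW : Measurable W) (hXY : IndepFun X Y P)
    (hXYW : IndepFun (fun ω => (X ω, Y ω)) W P) : IndepFun X (fun ω => (Y ω, W ω)) P := by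
  have hYW : IndepFun Y W P := hXYW.comp measurable_snd measurable_id
  have := Measure.isProbabilityMeasure_map (μ := P) hX.aemeasurable
  have := Measure.isProbabilityMeasure_map (μ := P) hY.aemeasurable
  have := Measure.isProbabilityMeasure_map (μ := P) hW.aemeasurable
  rw [indepFun_iff_map_prod_eq_prod_map_map hX.aemeasurable (hY.prodMk hW).aemeasurable,
    (indepFun_iff_map_prod_eq_prod_map_map hY.aemeasurable hW.aemeasurable).1 hYW]
  have h := (indepFun_iff_map_prod_eq_prod_map_map (hX.prodMk hY).aemeasurable
    hW.aemeasurable).1 hXYW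
  rw [(indepFun_iff_map_prod_eq_prod_map_map hX.aemeasurable hY.aemeasurable).1 hXY] at h
  rw [← Measure.prodAssoc_prod, ← h, Measure.map_map MeasurableEquiv.prodAssoc.measurable
    ((hX.prodMk hY).prodMk hW)]
  rfl

/-- The contribution of a claim reported after development year `r`, up to year `T`. -/
noncomputable def lateWeight (r T : ℕ) (p : ℕ × ℝ) : ℝ := if r < p.1 ∧ p.1 ≤ T then p.2 else 0

theorem measurable_lateWeight (r T : ℕ) : Measurable (lateWeight r T) :=
  Measurable.ite ((measurableSet_lt measurable_const measurable_fst).inter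
    (measurableSet_le measurable_fst measurable_const)) measurable_snd measurable_const

theorem weight_add_lateWeight {r T : ℕ} (h : r ≤ T) (p : ℕ × ℝ) :
    weight r p + lateWeight r T p = weight T p := by
  unfold weight lateWeight
  split_ifs <;> first | omega | simp

theorem aggregate_add (g h : ℕ × ℝ → ℝ) (α : ℝ≥0) (x : (ℝ≥0 → ℕ) × (ℕ → ℕ × ℝ)) :
    aggregate (fun p => g p + h p) α x = aggregate g α x + aggregate h α x :=
  Finset.sum_add_distrib

theorem aggregate_sub (g h : ℕ × ℝ → ℝ) (α : ℝ≥0) (x : (ℝ≥0 → ℕ) × (ℕ → ℕ × ℝ)) :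
    aggregate (fun p => g p - h p) α x = aggregate g α x - aggregate h α x :=
  Finset.sum_sub_distrib _ _

theorem aggregate_const_mul (c : ℝ) (h : ℕ × ℝ → ℝ) (α : ℝ≥0)
    (x : (ℝ≥0 → ℕ) × (ℕ → ℕ × ℝ)) :
    aggregate (fun p => c * h p) α x = c * aggregate h α x :=
  (Finset.mul_sum _ _ _).symm

theorem aggregate_sum {κ : Type*} (s : Finset κ) (h : κ → ℕ × ℝ → ℝ) (α : ℝ≥0)
    (x : (ℝ≥0 → ℕ) × (ℕ → ℕ × ℝ)) :
    aggregate (fun p => ∑ k ∈ s, h k p) α x = ∑ k ∈ s, aggregate (h k) α x :=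
  Finset.sum_comm

theorem predError_eq {Ω : Type*} {T : ℕ} {ν : Measure (ℕ × ℝ)} {D : ℕ → ℕ → Ω → ℕ}
    {Z : ℕ → ℕ → Ω → ℝ} {M : ℕ → ℝ≥0 → Ω → ℕ} {i : ℕ} (hi : i ∈ Finset.Icc 1 T) (α : ℝ≥0) :
    predError T ν D Z M i α = fun ω =>
      (1 - factorProd T ν i) * accClaims D Z M i (T - i + 1) α ω +
        aggregate (lateWeight (T - i + 1) T) α (yearData D Z M i ω) := by
  obtain ⟨h1, h2⟩ := Finset.mem_Icc.1 hi
  ext ω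
  have h := aggregate_add (weight (T - i + 1)) (lateWeight (T - i + 1) T) α (yearData D Z M i ω)
  simp_rw [weight_add_lateWeight (show T - i + 1 ≤ T by omega)] at h
  simp only [predError, accClaims_eq_aggregate]
  rw [show aggregate (weight T) α (yearData D Z M i ω) = _ from h]
  ring

variable {Ω : Type*} [MeasurableSpace Ω] {P : Measure Ω} {T : ℕ} {lam : ℕ → ℝ≥0}
  {ν : Measure (ℕ × ℝ)} {D : ℕ → ℕ → Ω → ℕ} {Z : ℕ → ℕ → Ω → ℝ} {M : ℕ → ℝ≥0 → Ω → ℕ} {i : ℕ}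

namespace IsSpecialModel

theorem triangleSigma_le (hm : IsSpecialModel P T lam ν D Z M) (α : ℝ≥0) :
    triangleSigma T D Z M α ≤ ‹MeasurableSpace Ω› :=
  iSup₂_le fun _ hj => iSup₂_le fun t _ => iSup_le fun _ =>
    (hm.measurable_accClaims hj t α).comap_le

variable [IsProbabilityMeasure P]

theorem integrable_lateWeight (hm : IsSpecialModel P T lam ν D Z M) (hT : 1 ≤ T) (r : ℕ) :
    Integrable (lateWeight r T) ν :=
  have := hm.isProbabilityMeasure hT
  (hm.memLp_of_le_size (measurable_lateWeight r T) fun p => by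
    unfold lateWeight
    split_ifs <;> simp).integrable (by norm_num)

theorem integrable_accClaims (hm : IsSpecialModel P T lam ν D Z M) (hi : i ∈ Finset.Icc 1 T)
    (t : ℕ) (α : ℝ≥0) : Integrable (accClaims D Z M i t α) P :=
  (hm.isPoissonMarked hi α).integrable_sum (measurable_weight t)
    (hm.integrable_weight ((Finset.mem_Icc.1 hi).1.trans (Finset.mem_Icc.1 hi).2) t)

theorem integrable_predError (hm : IsSpecialModel P T lam ν D Z M) (hi : i ∈ Finset.Icc 1 T)
    (α : ℝ≥0) : Integrable (predError T ν D Z M i α) P :=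
  (hm.integrable_accClaims hi T α).sub ((hm.integrable_accClaims hi _ α).mul_const _)

theorem integral_lateWeight (hm : IsSpecialModel P T lam ν D Z M) {r : ℕ} (hT : 1 ≤ T)
    (hr : r ≤ T) : ∫ p, lateWeight r T p ∂ν = cumMean ν T - cumMean ν r := by
  rw [cumMean, ← integral_congr_ae (ae_of_all _ (weight_add_lateWeight hr)),
    integral_add (hm.integrable_weight hT r) (hm.integrable_lateWeight hT r), cumMean]
  ring

/-- The late claims of accident year `i` are independent of the observed triangle: of the early
claims of the same year by Poisson thinning, of the other years by assumption. -/
theorem indep_lateClaims_triangleSigma (hm : IsSpecialModel P T lam ν D Z M)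
    (hi : i ∈ Finset.Icc 1 T) (α : ℝ≥0) :
    Indep (MeasurableSpace.comap
      (fun ω => aggregate (lateWeight (T - i + 1) T) α (yearData D Z M i ω)) inferInstance)
      (triangleSigma T D Z M α) P := by
  obtain ⟨h1, h2⟩ := Finset.mem_Icc.1 hi
  set r := T - i + 1 with hr
  have H := hm.isPoissonMarked hi α
  let g : ℕ × ℝ → Finset.Icc 1 r → ℝ := fun p t => weight t p
  have hg : Measurable g := measurable_pi_lambda _ fun t => measurable_weight t
  have hdisj : ∀ p, lateWeight r T p = 0 ∨ g p = 0 := fun p => by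
    rcases le_or_gt p.1 r with h | h
    · left
      simp [lateWeight, not_lt.2 h]
    · right
      ext t
      have := (Finset.mem_Icc.1 t.2).2
      simp [g, weight, show ¬p.1 ≤ t.1 by omega]
  let G : (ℝ≥0 → ℕ) × (ℕ → ℕ × ℝ) → Finset.Icc 1 r → ℝ :=
    aggregate g α
  have hG : Measurable G := measurable_aggregate hg α
  have hyear := hm.measurable_yearData hi
  have hU := measurable_aggregate (measurable_lateWeight r T) α
  have hothers : Measurable
      (fun ω (j : (Finset.univ.erase (⟨i, hi⟩ : Finset.Icc 1 T) : Finset (Finset.Icc 1 T))) =>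
        yearData D Z M j.1 ω) := measurable_pi_lambda _ fun j => hm.measurable_yearData j.1.2
  have hthin : IndepFun (fun ω => aggregate (lateWeight r T) α (yearData D Z M i ω))
      (fun ω => G (yearData D Z M i ω)) P :=
    H.indepFun_sum (measurable_lateWeight r T) hg hdisj
  have hind := indepFun_prodMk_of_indepFun_prodMk (hU.comp hyear) (hG.comp hyear) hothers hthin
    ((hm.indepFun_yearData hi).comp (hU.prodMk hG) measurable_id)
  refine indep_of_indep_of_le_right ((IndepFun_iff_Indep _ _ _).1 hind) ?_
  -- The observed amounts of year `i` have `t ≤ T - i + 1`; all others belong to other years.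
  refine iSup₂_le fun j hj => iSup₂_le fun t ht => iSup_le fun hjt => ?_
  have hcomap := comap_measurable (m := Prod.instMeasurableSpace) (fun ω =>
    (G (yearData D Z M i ω),
      fun (j : (Finset.univ.erase (⟨i, hi⟩ : Finset.Icc 1 T) : Finset (Finset.Icc 1 T))) =>
        yearData D Z M j.1 ω))
  by_cases hji : j = i
  · subst hji
    have htr : t ∈ Finset.Icc 1 r := Finset.mem_Icc.2 ⟨(Finset.mem_Icc.1 ht).1, by omega⟩
    have heq : accClaims D Z M j t α = fun ω => G (yearData D Z M j ω) ⟨t, htr⟩ := by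
      ext ω
      simp [G, g, accClaims_eq_aggregate, aggregate, Finset.sum_apply]
    rw [heq]
    exact (((measurable_pi_apply _).comp measurable_fst).comp hcomap).comap_le
  · have hmem : (⟨j, hj⟩ : Finset.Icc 1 T) ∈ Finset.univ.erase (⟨i, hi⟩ : Finset.Icc 1 T) := by
      simp [hji]
    exact ((((measurable_aggregate (measurable_weight t) α).comp
      (measurable_pi_apply ⟨⟨j, hj⟩, hmem⟩)).comp measurable_snd).comp hcomap).comap_le

/-- The prediction error, conditioned on the observed triangle, is almost surely a centred sum over
the claims of accident year `i` observed so far. -/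
theorem A1_ae_eq (hm : IsSpecialModel P T lam ν D Z M) (hi : i ∈ Finset.Icc 1 T) (α : ℝ≥0) :
    A1 P T ν D Z M i α =ᵐ[P] fun ω => (α : ℝ) ^ (-(1 / 2) : ℝ) *
      (aggregate (fun p => (1 - factorProd T ν i) * weight (T - i + 1) p) α (yearData D Z M i ω) -
        lam i * α * ∫ p, (1 - factorProd T ν i) * weight (T - i + 1) p ∂ν) := by
  obtain ⟨h1, h2⟩ := Finset.mem_Icc.1 hi
  have hT : 1 ≤ T := h1.trans h2
  set r := T - i + 1 with hr
  have hrT : r ∈ Finset.Icc 1 T := Finset.mem_Icc.2 ⟨by omega, by omega⟩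
  have hUm : Measurable fun ω => aggregate (lateWeight r T) α (yearData D Z M i ω) :=
    (measurable_aggregate (measurable_lateWeight r T) α).comp (hm.measurable_yearData hi)
  have hUint : Integrable (fun ω => aggregate (lateWeight r T) α (yearData D Z M i ω)) P :=
    (hm.isPoissonMarked hi α).integrable_sum (measurable_lateWeight r T)
      (hm.integrable_lateWeight hT r)
  have hC : StronglyMeasurable[triangleSigma T D Z M α]
      (fun ω => (1 - factorProd T ν i) * accClaims D Z M i r α ω) := by
    have : Measurable[triangleSigma T D Z M α] (accClaims D Z M i r α) := by
      refine Measurable.mono (comap_measurable _) ?_ le_rfl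
      exact le_iSup₂_of_le i hi (le_iSup₂_of_le r hrT (le_iSup_of_le (by omega) le_rfl))
    exact (this.const_mul _).stronglyMeasurable
  have hle := hm.triangleSigma_le α
  have hcond := condExp_indep_eq hUm.comap_le hle
    (Measurable.stronglyMeasurable (comap_measurable _)) (hm.indep_lateClaims_triangleSigma hi α)
  have hint := (hm.isPoissonMarked hi α).integral_sum (measurable_lateWeight r T)
    (hm.integrable_lateWeight hT r)
  rw [hm.integral_lateWeight hT (Finset.mem_Icc.1 hrT).2] at hint
  have hadd := condExp_add ((hm.integrable_accClaims hi r α).const_mul (1 - factorProd T ν i)) hUint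
    (triangleSigma T D Z M α)
  have hpos := hm.cumMean_pos hrT
  have hmean : ∫ p, (1 - factorProd T ν i) * weight r p ∂ν = cumMean ν r - cumMean ν T := by
    rw [integral_const_mul, hm.factorProd_eq hi, ← hr]
    change (1 - cumMean ν T / cumMean ν r) * cumMean ν r = _
    field_simp
  rw [hmean]
  have hpred : predError T ν D Z M i α = (fun ω => (1 - factorProd T ν i) *
      accClaims D Z M i r α ω) + fun ω => aggregate (lateWeight r T) α (yearData D Z M i ω) :=
    predError_eq hi α
  filter_upwards [hadd, hcond] with ω hω hω'
  rw [A1, hpred, hω, Pi.add_apply, hω', condExp_of_stronglyMeasurable hle hC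
    ((hm.integrable_accClaims hi r α).const_mul _), aggregate_const_mul]
  congr 1
  rw [show ∫ ω, aggregate (lateWeight r T) α (yearData D Z M i ω) ∂P = _ from hint]
  simp only [accClaims_eq_aggregate]
  push_cast
  ring

end IsSpecialModel

end PredictionError

/-! ### Asymptotics of the chain ladder estimators -/

section Estimator

/-- The scaled denominator `α⁻¹ ∑_{j ≤ T-s} C^α_{j,t}`. -/
noncomputable def avgClaims {Ω : Type*} (T : ℕ) (D : ℕ → ℕ → Ω → ℕ) (Z : ℕ → ℕ → Ω → ℝ)
    (M : ℕ → ℝ≥0 → Ω → ℕ) (s t : ℕ) (α : ℝ≥0) (ω : Ω) : ℝ :=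
  (α : ℝ)⁻¹ * ∑ j ∈ Finset.Icc 1 (T - s), accClaims D Z M j t α ω

/-- The scaled numerator `α^{-1/2} ∑_{j ≤ T-s} (C^α_{j,s+1} - f_s C^α_{j,s})` of the estimation
error of the development factor `f_s`. -/
noncomputable def devError {Ω : Type*} (T : ℕ) (ν : Measure (ℕ × ℝ)) (D : ℕ → ℕ → Ω → ℕ)
    (Z : ℕ → ℕ → Ω → ℝ) (M : ℕ → ℝ≥0 → Ω → ℕ) (s : ℕ) (α : ℝ≥0) (ω : Ω) : ℝ :=
  (α : ℝ) ^ (-(1 / 2) : ℝ) * ∑ j ∈ Finset.Icc 1 (T - s),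
    (accClaims D Z M j (s + 1) α ω - devFactor ν s * accClaims D Z M j s α ω)

/-- The contribution of a claim to `C_{j,s+1} - f_s C_{j,s}`. -/
noncomputable def devWeight (ν : Measure (ℕ × ℝ)) (s : ℕ) (p : ℕ × ℝ) : ℝ :=
  weight (s + 1) p - devFactor ν s * weight s p

/-- The random coefficient of `devError` at `s` in the telescoping expansion of the estimation
error of the product of the development factors. -/
noncomputable def randCoeff {Ω : Type*} (T : ℕ) (ν : Measure (ℕ × ℝ)) (D : ℕ → ℕ → Ω → ℕ)
    (Z : ℕ → ℕ → Ω → ℝ) (M : ℕ → ℝ≥0 → Ω → ℕ) (i s : ℕ) (α : ℝ≥0) (ω : Ω) : ℝ :=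
  (∏ u ∈ Finset.Ico (T - i + 1) T with u < s, devFactorEst T D Z M u α ω) *
    (∏ u ∈ Finset.Ico (T - i + 1) T with s < u, devFactor ν u) / avgClaims T D Z M s s α ω

/-- The limit of `randCoeff`. -/
noncomputable def limCoeff (T : ℕ) (lam : ℕ → ℝ≥0) (ν : Measure (ℕ × ℝ)) (i s : ℕ) : ℝ :=
  (∏ u ∈ Finset.Ico (T - i + 1) T with u < s, devFactor ν u) *
    (∏ u ∈ Finset.Ico (T - i + 1) T with s < u, devFactor ν u) /
      ((∑ j ∈ Finset.Icc 1 (T - s), (lam j : ℝ)) * cumMean ν s)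

/-- The contribution of a claim of accident year `j` to the linearization of `A₂`. -/
noncomputable def linWeight (T : ℕ) (lam : ℕ → ℝ≥0) (ν : Measure (ℕ × ℝ)) (i j : ℕ)
    (p : ℕ × ℝ) : ℝ :=
  ∑ s ∈ Finset.Ico (T - i + 1) T with j ≤ T - s, -limCoeff T lam ν i s * devWeight ν s p

theorem measurable_devWeight (ν : Measure (ℕ × ℝ)) (s : ℕ) : Measurable (devWeight ν s) :=
  (measurable_weight _).sub ((measurable_weight _).const_mul _)

theorem measurable_linWeight (T : ℕ) (lam : ℕ → ℝ≥0) (ν : Measure (ℕ × ℝ)) (i j : ℕ) :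
    Measurable (linWeight T lam ν i j) :=
  Finset.measurable_fun_sum _ fun s _ => (measurable_devWeight ν s).const_mul _

theorem aggregate_devWeight {Ω : Type*} (ν : Measure (ℕ × ℝ)) (D : ℕ → ℕ → Ω → ℕ)
    (Z : ℕ → ℕ → Ω → ℝ) (M : ℕ → ℝ≥0 → Ω → ℕ) (j s : ℕ) (α : ℝ≥0) (ω : Ω) :
    aggregate (devWeight ν s) α (yearData D Z M j ω) =
      accClaims D Z M j (s + 1) α ω - devFactor ν s * accClaims D Z M j s α ω := by
  simp only [accClaims_eq_aggregate, ← aggregate_const_mul, ← aggregate_sub]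
  rfl

theorem rpow_half_spec {a : ℝ} (ha : 0 < a) :
    0 < a ^ (1 / 2 : ℝ) ∧ a ^ (-(1 / 2) : ℝ) = (a ^ (1 / 2 : ℝ))⁻¹ ∧
      a = (a ^ (1 / 2 : ℝ)) ^ 2 := by
  refine ⟨Real.rpow_pos_of_pos ha _, Real.rpow_neg ha.le _, ?_⟩
  rw [← Real.rpow_natCast, ← Real.rpow_mul ha.le]
  norm_num

/-- The linearization of `A₂` as a sum over the claims of the years before `i`. -/
theorem sum_limCoeff_mul_devError {Ω : Type*} {T : ℕ} (lam : ℕ → ℝ≥0) (ν : Measure (ℕ × ℝ))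
    (D : ℕ → ℕ → Ω → ℕ) (Z : ℕ → ℕ → Ω → ℝ) (M : ℕ → ℝ≥0 → Ω → ℕ) {i : ℕ}
    (hi : i ∈ Finset.Icc 1 T) (α : ℝ≥0) (ω : Ω) :
    (α : ℝ) ^ (-(1 / 2) : ℝ) * ∑ j ∈ Finset.Icc 1 (i - 1),
        aggregate (linWeight T lam ν i j) α (yearData D Z M j ω) =
      -∑ s ∈ Finset.Ico (T - i + 1) T, devError T ν D Z M s α ω * limCoeff T lam ν i s := by
  obtain ⟨h1, h2⟩ := Finset.mem_Icc.1 hi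
  -- `j ≤ T - s` with `s ≥ T - i + 1` forces `j ≤ i - 1`, so both orders range over the same pairs.
  have hswap : ∑ j ∈ Finset.Icc 1 (i - 1), ∑ s ∈ Finset.Ico (T - i + 1) T with j ≤ T - s,
      -limCoeff T lam ν i s * aggregate (devWeight ν s) α (yearData D Z M j ω) =
      ∑ s ∈ Finset.Ico (T - i + 1) T, ∑ j ∈ Finset.Icc 1 (T - s),
        -limCoeff T lam ν i s * aggregate (devWeight ν s) α (yearData D Z M j ω) := by
    refine Finset.sum_comm' fun j s => ?_
    simp only [Finset.mem_Icc, Finset.mem_filter, Finset.mem_Ico]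
    omega
  have hagg : ∀ j, aggregate (linWeight T lam ν i j) α (yearData D Z M j ω) =
      ∑ s ∈ Finset.Ico (T - i + 1) T with j ≤ T - s,
        -limCoeff T lam ν i s * aggregate (devWeight ν s) α (yearData D Z M j ω) := fun j => by
    simp only [← aggregate_const_mul, ← aggregate_sum]
    rfl
  simp only [hagg, hswap, devError, ← aggregate_devWeight]
  rw [Finset.mul_sum, ← Finset.sum_neg_distrib]
  refine Finset.sum_congr rfl fun s _ => ?_
  rw [← Finset.mul_sum]
  ring

/-- The telescoping expansion of the estimation error, wherever no denominator vanishes. -/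
theorem A2_eq_neg_sum {Ω : Type*} {T : ℕ} (ν : Measure (ℕ × ℝ)) (D : ℕ → ℕ → Ω → ℕ)
    (Z : ℕ → ℕ → Ω → ℝ) (M : ℕ → ℝ≥0 → Ω → ℕ) (i : ℕ) {α : ℝ≥0} (hα : 0 < α) {ω : Ω}
    (hω : ∀ s ∈ Finset.Ico (T - i + 1) T, avgClaims T D Z M s s α ω ≠ 0) :
    A2 T ν D Z M i α ω =
      -∑ s ∈ Finset.Ico (T - i + 1) T, devError T ν D Z M s α ω * randCoeff T ν D Z M i s α ω := by
  have hα' : (0 : ℝ) < α := by exact_mod_cast hα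
  obtain ⟨ha, ha1, ha2⟩ := rpow_half_spec hα'
  -- Expand `∏ f̂_s = ∏ (f_s + (f̂_s - f_s))`, with estimators before `s` and factors after `s`.
  have hprod := Finset.prod_add_ordered (Finset.Ico (T - i + 1) T) (fun s => devFactor ν s)
    fun s => devFactorEst T D Z M s α ω - devFactor ν s
  simp only [add_sub_cancel] at hprod
  rw [A2, factorEstProd, hprod, factorProd, sub_add_cancel_left, mul_neg, Finset.mul_sum]
  congr 1
  refine Finset.sum_congr rfl fun s hs => ?_
  have hB := hω s hs
  have hC : ∑ j ∈ Finset.Icc 1 (T - s), accClaims D Z M j s α ω ≠ 0 := fun h => hB (by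
    rw [avgClaims, h, mul_zero])
  have key : (α : ℝ) ^ (1 / 2 : ℝ) * (devFactorEst T D Z M s α ω - devFactor ν s) =
      devError T ν D Z M s α ω / avgClaims T D Z M s s α ω := by
    rw [devFactorEst, devError, avgClaims, Finset.sum_sub_distrib, ← Finset.mul_sum, ha1]
    generalize (α : ℝ) ^ (1 / 2 : ℝ) = a at *
    rw [ha2]
    field_simp
  rw [← mul_assoc, ← mul_assoc, key, randCoeff]
  ring

/-- `A₂` is measurable with respect to any σ-algebra that makes the claims of the accident years
before `i` measurable. -/
theorem measurable_A2 {Ω : Type*} {mΩ : MeasurableSpace Ω} {T : ℕ} (ν : Measure (ℕ × ℝ))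
    {D : ℕ → ℕ → Ω → ℕ} {Z : ℕ → ℕ → Ω → ℝ} {M : ℕ → ℝ≥0 → Ω → ℕ} {i : ℕ} {α : ℝ≥0}
    (h : ∀ j ∈ Finset.Icc 1 T, j < i → ∀ t, Measurable (accClaims D Z M j t α)) :
    Measurable (A2 T ν D Z M i α) := by
  refine Measurable.const_mul (measurable_const.sub
    (Finset.measurable_fun_prod _ fun s hs => ?_)) _
  have hj : ∀ j ∈ Finset.Icc 1 (T - s), ∀ t, Measurable (accClaims D Z M j t α) := fun j hj =>
    h j (Finset.mem_Icc.2 ⟨(Finset.mem_Icc.1 hj).1, by have := (Finset.mem_Icc.1 hj).2; omega⟩)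
      (by have := (Finset.mem_Icc.1 hj).2; have := Finset.mem_Ico.1 hs; omega)
  exact (Finset.measurable_fun_sum _ fun j hj' => hj j hj' _).div
    (Finset.measurable_fun_sum _ fun j hj' => hj j hj' _)

variable {Ω : Type*} [MeasurableSpace Ω] {P : Measure Ω} {T : ℕ} {lam : ℕ → ℝ≥0}
  {ν : Measure (ℕ × ℝ)} {D : ℕ → ℕ → Ω → ℕ} {Z : ℕ → ℕ → Ω → ℝ} {M : ℕ → ℝ≥0 → Ω → ℕ} {i : ℕ}

namespace IsSpecialModel

theorem memLp_devWeight (hm : IsSpecialModel P T lam ν D Z M) (s : ℕ) :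
    MemLp (devWeight ν s) 2 ν :=
  (hm.memLp_weight _).sub ((hm.memLp_weight _).const_mul _)

theorem memLp_linWeight (hm : IsSpecialModel P T lam ν D Z M) (i j : ℕ) :
    MemLp (linWeight T lam ν i j) 2 ν :=
  memLp_finsetSum _ fun s _ => (hm.memLp_devWeight s).const_mul _

theorem measurable_avgClaims (hm : IsSpecialModel P T lam ν D Z M) (s t : ℕ) (α : ℝ≥0) :
    Measurable (avgClaims T D Z M s t α) :=
  (Finset.measurable_fun_sum _ fun _ hj => hm.measurable_accClaims
    (Finset.Icc_subset_Icc_right (Nat.sub_le T s) hj) t α).const_mul _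

theorem measurable_devFactorEst (hm : IsSpecialModel P T lam ν D Z M) (s : ℕ) (α : ℝ≥0) :
    Measurable (devFactorEst T D Z M s α) :=
  (Finset.measurable_fun_sum _ fun _ hj => hm.measurable_accClaims
    (Finset.Icc_subset_Icc_right (Nat.sub_le T s) hj) _ α).div
  (Finset.measurable_fun_sum _ fun _ hj => hm.measurable_accClaims
    (Finset.Icc_subset_Icc_right (Nat.sub_le T s) hj) _ α)

theorem measurable_randCoeff (hm : IsSpecialModel P T lam ν D Z M) (i s : ℕ) (α : ℝ≥0) :
    Measurable (randCoeff T ν D Z M i s α) :=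
  ((Finset.measurable_fun_prod _ fun u _ => hm.measurable_devFactorEst u α).mul_const _).div
    (hm.measurable_avgClaims s s α)

theorem sum_intensity_pos (hm : IsSpecialModel P T lam ν D Z M) {s : ℕ} (hs : s < T) :
    0 < ∑ j ∈ Finset.Icc 1 (T - s), (lam j : ℝ) :=
  Finset.sum_pos (fun j hj => by
    exact_mod_cast hm.intensity_pos j (Finset.Icc_subset_Icc_right (Nat.sub_le T s) hj))
    (Finset.nonempty_Icc.2 (by omega))

variable [IsProbabilityMeasure P]

theorem integral_devWeight (hm : IsSpecialModel P T lam ν D Z M) {s : ℕ}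
    (hs : s ∈ Finset.Icc 1 T) : ∫ p, devWeight ν s p ∂ν = 0 := by
  have hT : 1 ≤ T := (Finset.mem_Icc.1 hs).1.trans (Finset.mem_Icc.1 hs).2
  have hpos := hm.cumMean_pos hs
  unfold devWeight
  rw [integral_sub (hm.integrable_weight hT _) ((hm.integrable_weight hT _).const_mul _),
    integral_const_mul, devFactor_eq]
  change cumMean ν (s + 1) - cumMean ν (s + 1) / cumMean ν s * cumMean ν s = 0
  field_simp
  ring

theorem integral_linWeight (hm : IsSpecialModel P T lam ν D Z M) (hi : i ∈ Finset.Icc 1 T)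
    (j : ℕ) : ∫ p, linWeight T lam ν i j p ∂ν = 0 := by
  obtain ⟨h1, h2⟩ := Finset.mem_Icc.1 hi
  have := hm.isProbabilityMeasure (h1.trans h2)
  unfold linWeight
  rw [integral_finsetSum _ fun s _ =>
    ((hm.memLp_devWeight s).integrable (by norm_num)).const_mul _]
  refine Finset.sum_eq_zero fun s hs => ?_
  have hs' := Finset.mem_Ico.1 (Finset.mem_filter.1 hs).1
  rw [integral_const_mul, hm.integral_devWeight (Finset.mem_Icc.2 ⟨by omega, by omega⟩), mul_zero]

/-- A weak law of large numbers, obtained from the central limit theorem by one more division by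
`√α`. -/
theorem tendstoInMeasure_avgClaims (hm : IsSpecialModel P T lam ν D Z M) (s t : ℕ) :
    TendstoInMeasure P (avgClaims T D Z M s t) atTop
      fun _ => (∑ j ∈ Finset.Icc 1 (T - s), (lam j : ℝ)) * cumMean ν t := by
  have hJ : Finset.Icc 1 (T - s) ⊆ Finset.Icc 1 T := Finset.Icc_subset_Icc_right (Nat.sub_le T s)
  have hclt := hm.tendstoInDistribution_aggregate hJ (h := fun _ => weight t)
    (fun _ _ => measurable_weight t) (fun _ _ => hm.memLp_weight t)
    (v := Real.toNNReal (∑ j ∈ Finset.Icc 1 (T - s), lam j * ∫ p, weight t p ^ 2 ∂ν))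
    (Real.coe_toNNReal _ (Finset.sum_nonneg fun j _ =>
      mul_nonneg (lam j).coe_nonneg (integral_nonneg fun _ => sq_nonneg _)))
  have hzero := tendstoInMeasure_mul_zero_of_tendstoInDistribution hclt
    (tendstoInMeasure_of_tendsto (tendsto_rpow_neg_half.mono_right nhdsWithin_le_nhds))
    fun _ => aemeasurable_const
  have hadd := tendstoInMeasure_const_comp₂ (g := fun p => p.1 + p.2) (by fun_prop) hzero
    (tendstoInMeasure_const (a := (∑ j ∈ Finset.Icc 1 (T - s), (lam j : ℝ)) * cumMean ν t))
  simp only [zero_add] at hadd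
  refine tendstoInMeasure_of_eqOn_compl hadd (E := fun _ => ∅) (by simp) ?_
  filter_upwards [eventually_gt_atTop 0] with α hα ω _
  have hα' : (0 : ℝ) < α := by exact_mod_cast hα
  obtain ⟨ha, ha1, ha2⟩ := rpow_half_spec hα'
  rw [avgClaims, ha1, Finset.sum_sub_distrib, ← Finset.sum_mul, ← Finset.sum_mul]
  change _ = _ * (∑ j ∈ Finset.Icc 1 (T - s), accClaims D Z M j t α ω - _ * cumMean ν t) * _ + _
  generalize (α : ℝ) ^ (1 / 2 : ℝ) = a at *
  rw [ha2]
  field_simp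
  ring

/-- The chain ladder estimators are consistent. -/
theorem tendstoInMeasure_devFactorEst (hm : IsSpecialModel P T lam ν D Z M) {s : ℕ} (h1 : 1 ≤ s)
    (hs : s < T) :
    TendstoInMeasure P (devFactorEst T D Z M s) atTop fun _ => devFactor ν s := by
  have hlam := hm.sum_intensity_pos hs
  have hpos := hm.cumMean_pos (Finset.mem_Icc.2 ⟨h1, hs.le⟩)
  have h := tendstoInMeasure_const_comp₂ (g := fun p => p.1 / p.2)
    (ContinuousAt.div (by fun_prop) (by fun_prop) (mul_pos hlam hpos).ne')
    (hm.tendstoInMeasure_avgClaims s (s + 1)) (hm.tendstoInMeasure_avgClaims s s)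
  simp only [mul_div_mul_left _ _ hlam.ne', ← devFactor_eq] at h
  refine tendstoInMeasure_of_eqOn_compl h (E := fun _ => ∅) (by simp) ?_
  filter_upwards [eventually_gt_atTop 0] with α hα ω _
  have hα' : (α : ℝ)⁻¹ ≠ 0 := inv_ne_zero (by exact_mod_cast hα.ne')
  rw [avgClaims, avgClaims, mul_div_mul_left _ _ hα', devFactorEst]

theorem tendstoInMeasure_randCoeff (hm : IsSpecialModel P T lam ν D Z M) (i : ℕ) {s : ℕ}
    (hs : s ∈ Finset.Ico (T - i + 1) T) :
    TendstoInMeasure P (randCoeff T ν D Z M i s) atTop fun _ => limCoeff T lam ν i s := by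
  obtain ⟨h1, h2⟩ := Finset.mem_Ico.1 hs
  have hlam := hm.sum_intensity_pos h2
  have hpos := hm.cumMean_pos (t := s) (Finset.mem_Icc.2 ⟨by omega, h2.le⟩)
  have hest := tendstoInMeasure_const_finset_prod (P := P) (l := atTop)
    ((Finset.Ico (T - i + 1) T).filter (· < s)) (X := fun u => devFactorEst T D Z M u)
    (a := fun u => devFactor ν u) fun u hu => by
      have hu' := Finset.mem_Ico.1 (Finset.mem_filter.1 hu).1
      exact hm.tendstoInMeasure_devFactorEst (by omega) hu'.2
  change TendstoInMeasure P (fun α ω => randCoeff T ν D Z M i s α ω) atTop _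
  simp only [randCoeff, limCoeff]
  generalize (∏ u ∈ Finset.Ico (T - i + 1) T with s < u, devFactor ν u) = c
  exact tendstoInMeasure_const_comp₂ (g := fun p => p.1 * c / p.2)
    (ContinuousAt.div (by fun_prop) (by fun_prop) (mul_pos hlam hpos).ne') hest
    (hm.tendstoInMeasure_avgClaims s s)

theorem tendstoInDistribution_devError (hm : IsSpecialModel P T lam ν D Z M) {s : ℕ}
    (hs : s ∈ Finset.Icc 1 T) :
    ∃ v : ℝ≥0, TendstoInDistribution (devError T ν D Z M s) atTop (id : ℝ → ℝ) (fun _ => P)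
      (gaussianReal 0 v) := by
  have hJ : Finset.Icc 1 (T - s) ⊆ Finset.Icc 1 T := Finset.Icc_subset_Icc_right (Nat.sub_le T s)
  refine ⟨Real.toNNReal (∑ j ∈ Finset.Icc 1 (T - s), lam j * ∫ p, devWeight ν s p ^ 2 ∂ν), ?_⟩
  have hclt := hm.tendstoInDistribution_aggregate hJ (h := fun _ => devWeight ν s)
    (fun _ _ => measurable_devWeight ν s) (fun _ _ => hm.memLp_devWeight s)
    (Real.coe_toNNReal _ (Finset.sum_nonneg fun j _ =>
      mul_nonneg (lam j).coe_nonneg (integral_nonneg fun _ => sq_nonneg _)))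
  simpa only [hm.integral_devWeight hs, mul_zero, sub_zero, aggregate_devWeight] using! hclt

theorem limCoeff_pos (hm : IsSpecialModel P T lam ν D Z M) (i : ℕ) {s : ℕ}
    (hs : s ∈ Finset.Ico (T - i + 1) T) : 0 < limCoeff T lam ν i s := by
  obtain ⟨h1, h2⟩ := Finset.mem_Ico.1 hs
  have hf : ∀ u ∈ Finset.Ico (T - i + 1) T, 0 < devFactor ν u := fun u hu =>
    hm.devFactor_pos (by have := Finset.mem_Ico.1 hu; omega) (Finset.mem_Ico.1 hu).2
  exact div_pos (mul_pos (Finset.prod_pos fun u hu => hf u (Finset.mem_filter.1 hu).1)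
    (Finset.prod_pos fun u hu => hf u (Finset.mem_filter.1 hu).1))
    (mul_pos (hm.sum_intensity_pos h2) (hm.cumMean_pos (Finset.mem_Icc.2 ⟨by omega, h2.le⟩)))

/-- The delta method for the product of the chain ladder estimators: `A₂` is asymptotically
equivalent to its linearization. -/
theorem tendstoInMeasure_A2_sub (hm : IsSpecialModel P T lam ν D Z M)
    (hi : i ∈ Finset.Icc 1 T) :
    TendstoInMeasure P (fun α ω => A2 T ν D Z M i α ω - (α : ℝ) ^ (-(1 / 2) : ℝ) *
      ∑ j ∈ Finset.Icc 1 (i - 1), aggregate (linWeight T lam ν i j) α (yearData D Z M j ω))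
      atTop fun _ => 0 := by
  have hterm : ∀ s ∈ Finset.Ico (T - i + 1) T, TendstoInMeasure P (fun α ω =>
      devError T ν D Z M s α ω * (limCoeff T lam ν i s - randCoeff T ν D Z M i s α ω))
      atTop fun _ => 0 := fun s hs => by
    have hs' := Finset.mem_Ico.1 hs
    obtain ⟨v, hv⟩ := hm.tendstoInDistribution_devError (s := s)
      (Finset.mem_Icc.2 ⟨by omega, by omega⟩)
    refine tendstoInMeasure_mul_zero_of_tendstoInDistribution hv ?_
      fun α => ((hm.measurable_randCoeff i s α).const_sub _).aemeasurable
    have := tendstoInMeasure_const_comp₂ (g := fun p => p.1 - p.2) (by fun_prop)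
      (tendstoInMeasure_const (a := limCoeff T lam ν i s)) (hm.tendstoInMeasure_randCoeff i hs)
    simpa only [sub_self] using this
  have hsum := tendstoInMeasure_const_finset_sum _ hterm
  simp only [Finset.sum_const_zero] at hsum
  -- The expansion fails only where some denominator vanishes (a quotient by zero is zero there);
  -- this has probability tending to zero.
  have hbad : Tendsto (fun α => P (⋃ s ∈ Finset.Ico (T - i + 1) T,
      {ω | avgClaims T D Z M s s α ω = 0})) atTop (𝓝 0) := by
    have h0 : Tendsto (fun α => ∑ s ∈ Finset.Ico (T - i + 1) T,
        P {ω | avgClaims T D Z M s s α ω = 0}) atTop (𝓝 0) := by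
      rw [show (0 : ENNReal) = ∑ s ∈ Finset.Ico (T - i + 1) T, 0 by simp]
      refine tendsto_finsetSum _ fun s hs => ?_
      have hs' := Finset.mem_Ico.1 hs
      exact tendsto_measure_eq_zero_of_tendstoInMeasure (mul_pos (hm.sum_intensity_pos hs'.2)
        (hm.cumMean_pos (Finset.mem_Icc.2 ⟨by omega, hs'.2.le⟩))).ne'
        (hm.tendstoInMeasure_avgClaims s s)
    exact tendsto_of_tendsto_of_tendsto_of_le_of_le tendsto_const_nhds h0 (fun _ => zero_le)
      fun α => measure_biUnion_finset_le _ _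
  refine tendstoInMeasure_of_eqOn_compl hsum hbad ?_
  filter_upwards [eventually_gt_atTop 0] with α hα ω hω
  rw [A2_eq_neg_sum ν D Z M i hα fun s hs h0 => hω (Set.mem_biUnion hs h0),
    sum_limCoeff_mul_devError lam ν D Z M hi, neg_sub_neg, ← Finset.sum_sub_distrib]
  exact Finset.sum_congr rfl fun s _ => by ring

/-- For `i ≥ 2` the linearization of `A₂` is not degenerate: the weight of accident year `1` does
not vanish on claims reported in development year `T`. -/
theorem integral_linWeight_sq_pos (hm : IsSpecialModel P T lam ν D Z M)
    (hi : i ∈ Finset.Icc 1 T) (h2i : 2 ≤ i) : 0 < ∫ p, linWeight T lam ν i 1 p ^ 2 ∂ν := by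
  obtain ⟨h1, h2⟩ := Finset.mem_Icc.1 hi
  refine lt_of_le_of_ne (integral_nonneg fun _ => sq_nonneg _) fun h0 => ?_
  have hae := (integral_eq_zero_iff_of_nonneg (fun _ => sq_nonneg _)
    (hm.memLp_linWeight i 1).integrable_sq).1 h0.symm
  have hlast : T - 1 ∈ Finset.Ico (T - i + 1) T := Finset.mem_Ico.2 ⟨by omega, by omega⟩
  -- A claim reported in the last development year `T` only enters through the factor `f_{T-1}`.
  have hval : ∀ p : ℕ × ℝ, p.1 = T →
      linWeight T lam ν i 1 p = -limCoeff T lam ν i (T - 1) * p.2 := fun p hp => by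
    unfold linWeight
    rw [Finset.sum_eq_single_of_mem (T - 1) (Finset.mem_filter.2 ⟨hlast, by omega⟩)]
    · simp [devWeight, weight, hp, show T ≤ T - 1 + 1 by omega, show ¬T ≤ T - 1 by omega]
    · intro s hs hne
      have := Finset.mem_Ico.1 (Finset.mem_filter.1 hs).1
      simp [devWeight, weight, hp, show ¬T ≤ s + 1 by omega, show ¬T ≤ s by omega]
  have hzero : ∫ p, (if p.1 = T then p.2 else 0) ∂ν = 0 := by
    refine integral_eq_zero_of_ae ?_
    filter_upwards [hae] with p hp
    have hp0 : linWeight T lam ν i 1 p = 0 := by simpa using hp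
    by_cases hpT : p.1 = T
    · rw [hval p hpT, neg_mul, neg_eq_zero] at hp0
      simpa [hpT] using (mul_eq_zero.1 hp0).resolve_left (hm.limCoeff_pos i hlast).ne'
    · simp [hpT]
  exact (hm.mean_pos T (Finset.mem_Icc.2 ⟨by omega, le_rfl⟩)).ne' hzero

theorem tendstoInDistribution_A2 (hm : IsSpecialModel P T lam ν D Z M)
    (hi : i ∈ Finset.Icc 1 T) :
    ∃ v : ℝ≥0, (2 ≤ i → 0 < v) ∧ TendstoInDistribution (A2 T ν D Z M i) atTop
      (id : ℝ → ℝ) (fun _ => P) (gaussianReal 0 v) := by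
  obtain ⟨h1, h2⟩ := Finset.mem_Icc.1 hi
  have hJ : Finset.Icc 1 (i - 1) ⊆ Finset.Icc 1 T := Finset.Icc_subset_Icc_right (by omega)
  have hnonneg : ∀ j ∈ Finset.Icc 1 (i - 1),
      0 ≤ (lam j : ℝ) * ∫ p, linWeight T lam ν i j p ^ 2 ∂ν := fun j _ =>
    mul_nonneg (lam j).coe_nonneg (integral_nonneg fun _ => sq_nonneg _)
  refine ⟨Real.toNNReal (∑ j ∈ Finset.Icc 1 (i - 1), lam j * ∫ p, linWeight T lam ν i j p ^ 2 ∂ν),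
    fun h2i => Real.toNNReal_pos.2 (Finset.sum_pos' hnonneg ⟨1, Finset.mem_Icc.2 (by omega),
      mul_pos (by exact_mod_cast hm.intensity_pos 1 (Finset.mem_Icc.2 ⟨le_rfl, by omega⟩))
        (hm.integral_linWeight_sq_pos hi h2i)⟩), ?_⟩
  have hclt := hm.tendstoInDistribution_aggregate hJ (h := linWeight T lam ν i)
    (fun j _ => measurable_linWeight T lam ν i j) (fun j _ => hm.memLp_linWeight i j)
    (Real.coe_toNNReal _ (Finset.sum_nonneg hnonneg))
  simp only [hm.integral_linWeight hi, mul_zero, sub_zero] at hclt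
  refine tendstoInDistribution_of_tendstoInMeasure_sub _ _ hclt (hm.tendstoInMeasure_A2_sub hi)
    fun α => (measurable_A2 ν fun j hj _ t => hm.measurable_accClaims hj t α).aemeasurable

/-- The limit variance is positive for `i ≥ 2` because `∏ f_s = m_T / m_r ≠ 1` when `r < T`. -/
theorem tendstoInDistribution_A1 (hm : IsSpecialModel P T lam ν D Z M)
    (hi : i ∈ Finset.Icc 1 T) :
    ∃ v : ℝ≥0, (2 ≤ i → 0 < v) ∧ TendstoInDistribution (A1 P T ν D Z M i) atTop
      (id : ℝ → ℝ) (fun _ => P) (gaussianReal 0 v) := by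
  obtain ⟨h1, h2⟩ := Finset.mem_Icc.1 hi
  set h : ℕ × ℝ → ℝ := fun p => (1 - factorProd T ν i) * weight (T - i + 1) p with hdef
  have hnonneg : 0 ≤ (lam i : ℝ) * ∫ p, h p ^ 2 ∂ν :=
    mul_nonneg (lam i).coe_nonneg (integral_nonneg fun _ => sq_nonneg _)
  refine ⟨Real.toNNReal (lam i * ∫ p, h p ^ 2 ∂ν), fun h2i => Real.toNNReal_pos.2 ?_, ?_⟩
  · refine mul_pos (by exact_mod_cast hm.intensity_pos i hi) ?_
    refine lt_of_le_of_ne (integral_nonneg fun _ => sq_nonneg _) fun h0 => ?_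
    have hae := (integral_eq_zero_iff_of_nonneg (fun _ => sq_nonneg _)
      ((hm.memLp_weight (T - i + 1)).const_mul (1 - factorProd T ν i)).integrable_sq).1 h0.symm
    have hr := hm.cumMean_pos (t := T - i + 1) (Finset.mem_Icc.2 ⟨by omega, by omega⟩)
    have hlt := hm.cumMean_lt (s := T - i + 1) (t := T) (by omega) le_rfl
    have hF : 1 - factorProd T ν i ≠ 0 := by
      rw [hm.factorProd_eq hi, sub_ne_zero]
      exact ((one_lt_div hr).2 hlt).ne
    refine hr.ne' (integral_eq_zero_of_ae ?_)
    filter_upwards [hae] with p hp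
    have hp0 : h p = 0 := pow_eq_zero_iff two_ne_zero |>.1 hp
    exact (mul_eq_zero.1 hp0).resolve_left hF
  · have hclt := hm.tendstoInDistribution_aggregate (J := {i})
      (Finset.singleton_subset_iff.2 hi) (h := fun _ => h)
      (fun _ _ => (measurable_weight _).const_mul _) (fun _ _ => (hm.memLp_weight _).const_mul _)
      (v := Real.toNNReal (lam i * ∫ p, h p ^ 2 ∂ν)) (by
        rw [Finset.sum_singleton, Real.coe_toNNReal _ hnonneg])
    simp only [Finset.sum_singleton] at hclt
    exact hclt.congr (fun α => (hm.A1_ae_eq hi α).symm) (ae_eq_refl _)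

/-- `A₁` depends on accident year `i` only, up to null sets, and `A₂` on the earlier years. -/
theorem indepFun_A1_A2 (hm : IsSpecialModel P T lam ν D Z M) (hi : i ∈ Finset.Icc 1 T) :
    IndepFun (fun ω (α : ℝ≥0) => A1 P T ν D Z M i α ω) (fun ω (α : ℝ≥0) => A2 T ν D Z M i α ω)
      P := by
  suffices h : IndepFun (fun ω (α : ℝ≥0) => (α : ℝ) ^ (-(1 / 2) : ℝ) *
      (aggregate (fun p => (1 - factorProd T ν i) * weight (T - i + 1) p) α (yearData D Z M i ω) -
        lam i * α * ∫ p, (1 - factorProd T ν i) * weight (T - i + 1) p ∂ν))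
      (fun ω (α : ℝ≥0) => A2 T ν D Z M i α ω) P from
    h.process_congr_left fun α => (hm.A1_ae_eq hi α).symm
  have hind := (hm.indepFun_yearData hi).comp (measurable_pi_lambda
    (fun x (α : ℝ≥0) => (α : ℝ) ^ (-(1 / 2) : ℝ) *
      (aggregate (fun p => (1 - factorProd T ν i) * weight (T - i + 1) p) α x -
        lam i * α * ∫ p, (1 - factorProd T ν i) * weight (T - i + 1) p ∂ν)) fun α =>
    ((measurable_aggregate ((measurable_weight _).const_mul _) α).sub_const _).const_mul _)
    measurable_id
  refine indep_of_indep_of_le_right ((IndepFun_iff_Indep _ _ _).1 hind) ?_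
  have hcomap := comap_measurable (m := MeasurableSpace.pi) (fun ω
    (j : (Finset.univ.erase (⟨i, hi⟩ : Finset.Icc 1 T) : Finset (Finset.Icc 1 T))) =>
      yearData D Z M j.1 ω)
  refine Measurable.comap_le (@measurable_pi_lambda Ω ℝ≥0 (fun _ => ℝ)
    (MeasurableSpace.comap _ MeasurableSpace.pi) _ _ fun α => ?_)
  refine measurable_A2 ν fun j hj hji t => ?_
  have hmem : (⟨j, hj⟩ : Finset.Icc 1 T) ∈ Finset.univ.erase (⟨i, hi⟩ : Finset.Icc 1 T) := by
    simp [hji.ne]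
  exact ((measurable_aggregate (measurable_weight t) α).comp
    (measurable_pi_apply ⟨⟨j, hj⟩, hmem⟩)).comp hcomap

end IsSpecialModel

end Estimator

end ChainLadder

theorem mainTheorem4 {Ω : Type*} [MeasurableSpace Ω] (P : Measure Ω) [IsProbabilityMeasure P]
    (T : ℕ) (lam : ℕ → ℝ≥0) (ν : Measure (ℕ × ℝ)) (D : ℕ → ℕ → Ω → ℕ) (Z : ℕ → ℕ → Ω → ℝ)
    (M : ℕ → ℝ≥0 → Ω → ℕ) (hmodel : ChainLadder.IsSpecialModel P T lam ν D Z M)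
    (i : ℕ) (hi : i ∈ Finset.Icc 1 T) :
    (∀ α, Integrable (ChainLadder.predError T ν D Z M i α) P) ∧
    IndepFun (fun ω (α : ℝ≥0) => ChainLadder.A1 P T ν D Z M i α ω)
      (fun ω (α : ℝ≥0) => ChainLadder.A2 T ν D Z M i α ω) P ∧
    (∃ v₁ : ℝ≥0, (2 ≤ i → 0 < v₁) ∧
      TendstoInDistribution (fun α => ChainLadder.A1 P T ν D Z M i α) atTop
        (id : ℝ → ℝ) (fun _ => P) (gaussianReal 0 v₁)) ∧
    (∃ v₂ : ℝ≥0, (2 ≤ i → 0 < v₂) ∧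
      TendstoInDistribution (fun α => ChainLadder.A2 T ν D Z M i α) atTop
        (id : ℝ → ℝ) (fun _ => P) (gaussianReal 0 v₂)) ∧
    (∃ ρ : ProbabilityMeasure ℝ, Integrable (id : ℝ → ℝ) (ρ : Measure ℝ) ∧
      ∫ x, x ∂(ρ : Measure ℝ) = 0 ∧
      TendstoInDistribution
        (fun α ω => ChainLadder.A1 P T ν D Z M i α ω * ChainLadder.A2 T ν D Z M i α ω) atTop
        (id : ℝ → ℝ) (fun _ => P) (ρ : Measure ℝ)) := by
  have hind := hmodel.indepFun_A1_A2 hi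
  obtain ⟨v₁, hv₁, h₁⟩ := hmodel.tendstoInDistribution_A1 hi
  obtain ⟨v₂, hv₂, h₂⟩ := hmodel.tendstoInDistribution_A2 hi
  have hprod := ChainLadder.tendstoInDistribution_mul_of_indepFun h₁ h₂
    fun α => hind.comp (measurable_pi_apply α) (measurable_pi_apply α)
  have hmul : Measurable fun p : ℝ × ℝ => p.1 * p.2 := by fun_prop
  obtain ⟨ρ, hρ⟩ : ∃ ρ : ProbabilityMeasure ℝ, (ρ : Measure ℝ) =
      ((gaussianReal 0 v₁).prod (gaussianReal 0 v₂)).map fun p => p.1 * p.2 :=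
    ⟨⟨_, Measure.isProbabilityMeasure_map hmul.aemeasurable⟩, rfl⟩
  have hint : ∀ v : ℝ≥0, Integrable (fun x : ℝ => x) (gaussianReal 0 v) := fun v =>
    (memLp_id_gaussianReal 1).integrable le_rfl
  refine ⟨hmodel.integrable_predError hi, hind, ⟨v₁, hv₁, h₁⟩, ⟨v₂, hv₂, h₂⟩, ρ, ?_, ?_, ?_⟩
  · rw [hρ]
    exact (integrable_map_measure aestronglyMeasurable_id hmul.aemeasurable).2
      ((hint v₁).mul_prod (hint v₂))
  · rw [hρ, integral_map (f := fun x => x) hmul.aemeasurable aestronglyMeasurable_id]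
    simp [integral_prod_mul (fun x : ℝ => x) (fun x : ℝ => x), integral_id_gaussianReal]
  · refine ⟨hprod.forall_aemeasurable, aemeasurable_id, ?_⟩
    convert! hprod.tendsto using 2
    exact congrArg 𝓝 (Subtype.ext (Measure.map_id.trans hρ))
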